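/- **Setting.** Let $\mathcal A,\mathcal B$ be abelian categories and let $\Phi:\mathcal A\to\mathcal B$, $\Psi:\mathcal B\to\mathcal A$ be additive contravariant functors forming a right adjoint pair, i.e. $\mathrm{Hom}_{\mathcal A}(A,\Psi B)\cong\mathrm{Hom}_{\mathcal B}(B,\Phi A)$ naturally, with unit $\eta_A:A\to\Psi\Phi A$. For $*\in\{\emptyset,+,-,b\}$ let $\mathcal K^*$ be the homotopy category of (unbounded, bounded below, bounded above, bounded) complexes, and $\mathcal D^*$ its localization at the quasi-isomorphisms. Extend $\Phi$ and $\Psi$ termwise to complexes, $(\Phi X)^i=\Phi(X^{-i})$. Fix $*,\dagger\in\{\emptyset,+,-,b\}$ with $\Phi(\mathcal K^*(\mathcal A))\subseteq\mathcal K^\dagger(\mathcal B)$ and $\Psi(\mathcal K^\dagger(\mathcal B))\subseteq\mathcal K^*(\mathcal A)$. Assume that there are triangulated subcategories $\mathcal P\subseteq\mathcal K^*(\mathcal A)$ and $\mathcal Q\subseteq\mathcal K^\dagger(\mathcal B)$ such that every object of $\mathcal K^*(\mathcal A)$ (resp. $\mathcal K^\dagger(\mathcal B)$) receives a quasi-isomorphism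 from an object of $\mathcal P$ (resp. $\mathcal Q$), $\Phi$ (resp. $\Psi$) sends exact complexes in $\mathcal P$ (resp. $\mathcal Q$) to exact complexes, and $\Phi(\mathcal P)\subseteq\mathcal Q$. Let $\mathbf R^*\Phi:\mathcal D^*(\mathcal A)\to\mathcal D^\dagger(\mathcal B)$ and $\mathbf R^\dagger\Psi:\mathcal D^\dagger(\mathcal B)\to\mathcal D^*(\mathcal A)$ be the right derived functors, and suppose that they form a right adjoint pair induced by $(\Phi,\Psi)$: its unit $\hat\eta:\mathrm{id}\to\mathbf R^\dagger\Psi\,\mathbf R^*\Phi$ is such that for every $X\in\mathcal K^*(\mathcal A)$ the composition of $\hat\eta_X$ with $\mathbf R^\dagger\Psi(\Phi X\to\mathbf R^*\Phi X)$ is the composition $X\to\Psi\Phi X\to\mathbf R^\dagger\Psi(\Phi X)$, where $X\to\Psi\Phi X$ is $\eta$ applied termwise. Objects are regarded as complexes concentrated in degree $0$. An object $A$ of $\mathcal A$ is *$\Phi$-acyclic* if $H^i(\mathbf R^*\Phi A)=0$ for all $i\neq0$ (similarly for $\Psi$ and objects of $\mathcal B$), and *$\Psi$-$\Phi$-acyclic*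 if moreover $\Phi A$ is $\Psi$-acyclic. A category has *enough* objects of some kind if each of its objects is a quotient of one of that kind. $\Phi$ has *cohomological dimension $\le n$* if $H^i(\mathbf R^*\Phi A)=0$ for all $A\in\mathcal A$ and $|i|>n$. An object $A$ of $\mathcal A$ is *$\mathcal D$-reflexive* if $\hat\eta_A$ is an isomorphism in $\mathcal D^*(\mathcal A)$. **Theorem.** Assume that $\mathcal A$ has enough $\Psi$-$\Phi$-acyclic objects and $\mathcal B$ has enough $\Psi$-acyclic objects. If $\Phi$ has cohomological dimension $\le n$ ($n\ge 0$), then in any exact sequence $$M_1\xrightarrow{f_1}M_2\xrightarrow{f_2}\cdots\xrightarrow{f_n}M_{n+1}$$ of $\mathcal D$-reflexive objects of $\mathcal A$ (exact at $M_2,\dots,M_n$), the kernels and the cokernels of all the $f_i$, $1\le i\le n$, are $\mathcal D$-reflexive. In particular, if $\Phi$ has cohomological dimension at most one, the $\mathcal D$-reflexive objects form an exact abelian subcategory of $\mathcal A$: the full subcategory on them is abelian and its inclusion into $\mathcal A$ is exact. -/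

import Mathlib

open CategoryTheory CategoryTheory.Limits Opposite

universe v₁ v₂ v u₁ u₂ u

noncomputable section

namespace DReflexive

/-! ### Homotopy and derived categories with boundedness conditions -/

/-- The four boundedness conditions: none, bounded below, bounded above, bounded. -/
inductive Bound
  | unbounded
  | plus
  | minus
  | bounded

section Categories

variable (C : Type u) [Category.{v} C] [Abelian C]

/-- The cochain complexes which satisfy a boundedness condition. -/
def Bound.complexes : Bound → ObjectProperty (CochainComplex C ℤ)
  | .unbounded => fun _ => True
  | .plus => fun K => ∃ a : ℤ, K.IsStrictlyGE a
  | .minus => fun K => ∃ b : ℤ, K.IsStrictlyLE b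
  | .bounded => fun K => (∃ a : ℤ, K.IsStrictlyGE a) ∧ ∃ b : ℤ, K.IsStrictlyLE b

/-- The objects of the homotopy category whose underlying complex satisfies a boundedness
condition. -/
def Bound.objects (s : Bound) : ObjectProperty (HomotopyCategory C (ComplexShape.up ℤ)) :=
  fun X => s.complexes C X.as

/-- The homotopy category `K^s(C)`: complexes of objects of `C` which satisfy the boundedness
condition `s`, and homotopy classes of morphisms of complexes. -/
abbrev KCat (s : Bound) := (s.objects C).FullSubcategory

/-- The quasi-isomorphisms of `K^s(C)`. -/
def qis (s : Bound) : MorphismProperty (KCat C s) :=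
  (HomotopyCategory.quasiIso C (ComplexShape.up ℤ)).inverseImage (s.objects C).ι

/-- The derived category `D^s(C)`: the localization of `K^s(C)` at the quasi-isomorphisms. -/
abbrev DCat (s : Bound) := (qis C s).Localization

/-- The localization functor `K^s(C) ⥤ D^s(C)`. -/
abbrev locQ (s : Bound) : KCat C s ⥤ DCat C s := (qis C s).Q

/-- The cohomology functor `H^i : D^s(C) ⥤ C`. -/
def cohomology (s : Bound) (i : ℤ) : DCat C s ⥤ C :=
  Localization.Construction.lift
    ((s.objects C).ι ⋙ HomotopyCategory.homologyFunctor C (ComplexShape.up ℤ) i)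
    (fun _ _ _ hf => hf i)

variable {C}

/-- An object of `C` as a complex concentrated in degree zero. -/
def stalkComplex (A : C) : CochainComplex C ℤ :=
  (HomologicalComplex.single C (ComplexShape.up ℤ) 0).obj A

lemma stalkComplex_mem (s : Bound) (A : C) : s.complexes C (stalkComplex A) := by
  have h₁ : (stalkComplex A).IsStrictlyGE 0 := by unfold stalkComplex; infer_instance
  have h₂ : (stalkComplex A).IsStrictlyLE 0 := by unfold stalkComplex; infer_instance
  cases s
  · trivial
  · exact ⟨0, h₁⟩
  · exact ⟨0, h₂⟩
  · exact ⟨⟨0, h₁⟩, ⟨0, h₂⟩⟩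

/-- An object of `C` as a stalk complex in `K^s(C)`. -/
def stalkK (s : Bound) (A : C) : KCat C s :=
  ⟨(HomotopyCategory.quotient C (ComplexShape.up ℤ)).obj (stalkComplex A), stalkComplex_mem s A⟩

/-- An object of `C` as a stalk complex in `D^s(C)`. -/
def stalk (s : Bound) (A : C) : DCat C s := (locQ C s).obj (stalkK s A)

end Categories

/-! ### Contravariant functors on complexes

A contravariant functor from `𝒜` to `ℬ` is a functor `𝒜ᵒᵖ ⥤ ℬ`. -/

section Contravariant

variable {𝒜 : Type u₁} [Category.{v₁} 𝒜] [Abelian 𝒜] {ℬ : Type u₂} [Category.{v₂} ℬ] [Abelian ℬ]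

/-- The termwise extension of a contravariant functor to complexes:
in degree `i` it takes the value `F (X^{-i})`. -/
def onComplexes (F : 𝒜ᵒᵖ ⥤ ℬ) [F.Additive] : (CochainComplex 𝒜 ℤ)ᵒᵖ ⥤ CochainComplex ℬ ℤ :=
  (CochainComplex.opEquivalence 𝒜).functor ⋙ F.mapHomologicalComplex (ComplexShape.up ℤ)

/-- The termwise extension of a contravariant functor to homotopy categories. -/
def onHomotopy (F : 𝒜ᵒᵖ ⥤ ℬ) [F.Additive] :
    (HomotopyCategory 𝒜 (ComplexShape.up ℤ))ᵒᵖ ⥤ HomotopyCategory ℬ (ComplexShape.up ℤ) :=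
  Functor.leftOp (CategoryTheory.Quotient.lift (homotopic 𝒜 (ComplexShape.up ℤ))
    (onComplexes F ⋙ HomotopyCategory.quotient ℬ (ComplexShape.up ℤ)).rightOp
    (by
      rintro K L f g ⟨h⟩
      apply Quiver.Hom.unop_inj
      exact HomotopyCategory.eq_of_homotopy _ _
        (F.mapHomotopy (CochainComplex.homotopyOp h))))

/-- The extension of `F` maps `K^s(𝒜)` into `K^t(ℬ)`. -/
def MapsBound (F : 𝒜ᵒᵖ ⥤ ℬ) [F.Additive] (s t : Bound) : Prop :=
  ∀ X : CochainComplex 𝒜 ℤ, s.complexes 𝒜 X → t.complexes ℬ ((onComplexes F).obj (op X))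

/-- The termwise extension `K^s(𝒜) → K^t(ℬ)` of a contravariant functor. -/
def onK (F : 𝒜ᵒᵖ ⥤ ℬ) [F.Additive] {s t : Bound} (h : MapsBound F s t) :
    (KCat 𝒜 s)ᵒᵖ ⥤ KCat ℬ t :=
  (t.objects ℬ).lift ((s.objects 𝒜).ι.op ⋙ onHomotopy F) (fun X => h X.unop.obj.as X.unop.property)

/-! ### Derived functors -/

/-- `S` is a triangulated subcategory of `K^s(𝒜)` which computes the derived functor of `F`:
every object of `K^s(𝒜)` receives a quasi-isomorphism from an object of `S`, and `F` maps exact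
complexes in `S` to exact complexes. -/
structure IsAdapted (F : 𝒜ᵒᵖ ⥤ ℬ) [F.Additive] (s : Bound)
    (S : ObjectProperty (HomotopyCategory 𝒜 (ComplexShape.up ℤ))) : Prop where
  isTriangulated : S.IsTriangulated
  le_objects : S ≤ s.objects 𝒜
  exists_resolution : ∀ X : HomotopyCategory 𝒜 (ComplexShape.up ℤ), s.objects 𝒜 X →
    ∃ (P : HomotopyCategory 𝒜 (ComplexShape.up ℤ)) (f : P ⟶ X), S P ∧
      HomotopyCategory.quasiIso 𝒜 (ComplexShape.up ℤ) f
  map_exact : ∀ P : CochainComplex 𝒜 ℤ,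
    S ((HomotopyCategory.quotient 𝒜 (ComplexShape.up ℤ)).obj P) →
      P.Acyclic → ((onComplexes F).obj (op P)).Acyclic

/-- `(RF, α)` is the right derived functor `D^s(𝒜) → D^t(ℬ)` of the contravariant functor `F`:
`α` is the universal natural transformation from the composition of `F : K^s(𝒜) → K^t(ℬ)` with the
localization functor to a functor which factors through `D^s(𝒜)`. -/
abbrev IsDerived (F : 𝒜ᵒᵖ ⥤ ℬ) [F.Additive] {s t : Bound} (h : MapsBound F s t)
    (RF : (DCat 𝒜 s)ᵒᵖ ⥤ DCat ℬ t) (α : onK F h ⋙ locQ ℬ t ⟶ (locQ 𝒜 s).op ⋙ RF) : Prop :=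
  RF.IsRightDerivedFunctor α (qis 𝒜 s).op

/-- `H^i(RF A)` for an object `A` of `𝒜`. -/
def derivedCohomology {s t : Bound} (RF : (DCat 𝒜 s)ᵒᵖ ⥤ DCat ℬ t) (i : ℤ) (A : 𝒜) : ℬ :=
  (cohomology ℬ t i).obj (RF.obj (op (stalk s A)))

/-- `A` is acyclic for the functor with derived functor `RF`. -/
def IsAcyclicFor {s t : Bound} (RF : (DCat 𝒜 s)ᵒᵖ ⥤ DCat ℬ t) (A : 𝒜) : Prop :=
  ∀ i : ℤ, i ≠ 0 → IsZero (derivedCohomology RF i A)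

/-- The functor with derived functor `RF` has cohomological dimension at most `n`. -/
def CohomDimLE {s t : Bound} (RF : (DCat 𝒜 s)ᵒᵖ ⥤ DCat ℬ t) (n : ℕ) : Prop :=
  ∀ (A : 𝒜) (i : ℤ), (n : ℤ) < |i| → IsZero (derivedCohomology RF i A)

/-- Every object is the image of (that is, a quotient of) an object satisfying `P`. -/
def HasEnough {C : Type u} [Category.{v} C] (P : ObjectProperty C) : Prop :=
  ∀ A : C, ∃ (L : C) (f : L ⟶ A), P L ∧ Epi f

/-- `L` is `Ψ`-`Φ`-acyclic: `L` is `Φ`-acyclic and `Φ L` is `Ψ`-acyclic. -/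
def IsPsiPhiAcyclic (Φ : 𝒜ᵒᵖ ⥤ ℬ) {s t : Bound} (RΦ : (DCat 𝒜 s)ᵒᵖ ⥤ DCat ℬ t)
    (RΨ : (DCat ℬ t)ᵒᵖ ⥤ DCat 𝒜 s) (L : 𝒜) : Prop :=
  IsAcyclicFor RΦ L ∧ IsAcyclicFor RΨ (Φ.obj (op L))

/-! ### The adjunctions -/

section Adjunction

variable {Φ : 𝒜ᵒᵖ ⥤ ℬ} {Ψ : ℬᵒᵖ ⥤ 𝒜} [Φ.Additive] [Ψ.Additive]

/-- The termwise extension `X ⟶ Ψ Φ X` of the unit of a right adjoint pair `(Φ, Ψ)`. -/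
def unitComplex (adj : Φ.rightOp ⊣ Ψ) (X : CochainComplex 𝒜 ℤ) :
    X ⟶ (onComplexes Ψ).obj (op ((onComplexes Φ).obj (op X))) where
  f i := (X.XIsoOfEq (neg_neg i).symm).hom ≫ adj.unit.app (X.X (- -i))
  comm' i j hij := by
    have h₂ := adj.unit.naturality (X.d (- -i) (- -j))
    have h₃ : X.d i j ≫ (X.XIsoOfEq (neg_neg j).symm).hom =
        (X.XIsoOfEq (neg_neg i).symm).hom ≫ X.d (- -i) (- -j) := by simp
    exact (Category.assoc _ _ _).trans ((congrArg _ h₂.symm).trans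
      ((Category.assoc _ _ _).symm.trans ((congrArg (fun g => g ≫ adj.unit.app (X.X (- -j)))
        h₃.symm).trans (Category.assoc _ _ _))))

/-- The morphism `X ⟶ Ψ Φ X` in `K^s(𝒜)` given by the termwise extension of the unit. -/
def unitK (adj : Φ.rightOp ⊣ Ψ) {s t : Bound} (hΦ : MapsBound Φ s t) (hΨ : MapsBound Ψ t s)
    (X : KCat 𝒜 s) : X ⟶ (onK Ψ hΨ).obj (op ((onK Φ hΦ).obj (op X))) :=
  ObjectProperty.homMk
    ((HomotopyCategory.quotient 𝒜 (ComplexShape.up ℤ)).map (unitComplex adj X.obj.as))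

/-- The adjunction of derived functors `Radj` is induced by the adjunction `adj`: for every complex
`X`, the composition of the derived unit with `RΨ (Φ X → RΦ X)` agrees with the composition
`X → Ψ Φ X → RΨ (Φ X)`. -/
def IsInduced (adj : Φ.rightOp ⊣ Ψ) {s t : Bound} (hΦ : MapsBound Φ s t) (hΨ : MapsBound Ψ t s)
    {RΦ : (DCat 𝒜 s)ᵒᵖ ⥤ DCat ℬ t} (α : onK Φ hΦ ⋙ locQ ℬ t ⟶ (locQ 𝒜 s).op ⋙ RΦ)
    {RΨ : (DCat ℬ t)ᵒᵖ ⥤ DCat 𝒜 s} (β : onK Ψ hΨ ⋙ locQ 𝒜 s ⟶ (locQ ℬ t).op ⋙ RΨ)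
    (Radj : RΦ.rightOp ⊣ RΨ) : Prop :=
  ∀ X : KCat 𝒜 s,
    Radj.unit.app ((locQ 𝒜 s).obj X) ≫ RΨ.map (α.app (op X)).op =
      (locQ 𝒜 s).map (unitK adj hΦ hΨ X) ≫ β.app (op ((onK Φ hΦ).obj (op X)))

end Adjunction

/-- The `𝒟`-reflexive objects of `𝒜`: the unit of the derived adjunction is an isomorphism at the
stalk complex. -/
def reflexive {s t : Bound} {RΦ : (DCat 𝒜 s)ᵒᵖ ⥤ DCat ℬ t} {RΨ : (DCat ℬ t)ᵒᵖ ⥤ DCat 𝒜 s}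
    (Radj : RΦ.rightOp ⊣ RΨ) : ObjectProperty 𝒜 :=
  fun A => IsIso (Radj.unit.app (stalk s A))

end Contravariant

/-- A class of objects of an abelian category is an exact abelian subcategory: the full subcategory
is abelian and the inclusion functor is exact. -/
def IsExactAbelianSubcategory {C : Type u} [Category.{v} C] (P : ObjectProperty C) : Prop :=
  ∃ _ : Abelian P.FullSubcategory, PreservesFiniteLimits P.ι ∧ PreservesFiniteColimits P.ι

end DReflexive

end

/-! For an object `A`, consider the cone of the derived unit at the stalk complex of `A`. Then `A`
is 𝒟-reflexive exactly when this cone has no cohomology, and the proof follows the vanishing degree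
by degree: `UnitIsoAt adj S j` says that degree `j` of the cone vanishes.

Three facts suffice. The cone vanishes in every degree `j > 0`, because `ΨΦ` applied to a resolution
of `A` has no cohomology above `0` (`unitIsoAt_of_pos`). If `n ≠ 0`, it vanishes in every degree `j
< -n`, because the derived dual of `A` has no cohomology above `n` and `Ψ` reverses degrees
(`unitIsoAt_of_lt`). A short exact sequence with reflexive middle term shifts degrees: vanishing in
degree `j` at the quotient is vanishing in degree `j + 1` at the subobject (`unitIsoAt_X₃_iff`).

Number the maps from `0` and let `I` be the image of the `i`-th one. Exactness identifies each image
with the next kernel. Moving left, degree `j` at `I` becomes degree `j + i + 1` at the kernel of the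
first map, which is positive when `j ≥ -i`. Moving right, it becomes degree `j - (n - i)` at the
cokernel of the last map, which is below `-n` when `j < -i`. Hence all images are reflexive, and so
are the kernels and cokernels (`kernel_and_cokernel_of_exact`).

To compute the cone, adapted complexes are shown to compute the derived functors
(`IsAdapted.isIso_of_isDerived`). On a resolution the derived unit then becomes the termwise unit
(`isIso_unit_app_iff`), which is a morphism of triangles. -/

namespace DReflexive

open Pretriangulated
open scoped ZeroObject

/-! ### Bounded homotopy categories as triangulated subcategories -/

section BoundedHomotopyCategory

variable {C : Type u} [Category.{v} C] [Abelian C]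

lemma isStrictlyLE_mappingCone {K L : CochainComplex C ℤ} (f : K ⟶ L) (n₁ n₂ n : ℤ)
    [K.IsStrictlyLE n₁] [L.IsStrictlyLE n₂] (hn₁ : n₁ ≤ n + 1) (hn₂ : n₂ ≤ n) :
    (CochainComplex.mappingCone f).IsStrictlyLE n := by
  rw [CochainComplex.isStrictlyLE_iff]
  intro i hi
  simp only [CochainComplex.mappingCone.isZero_X_iff]
  exact ⟨K.isZero_of_isStrictlyLE n₁ _, L.isZero_of_isStrictlyLE n₂ _⟩

lemma Bound.complexes_mappingCone (s : Bound) {K L : CochainComplex C ℤ} (f : K ⟶ L)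
    (hK : s.complexes C K) (hL : s.complexes C L) :
    s.complexes C (CochainComplex.mappingCone f) := by
  have ge : (∃ a : ℤ, K.IsStrictlyGE a) → (∃ a : ℤ, L.IsStrictlyGE a) →
      ∃ a : ℤ, (CochainComplex.mappingCone f).IsStrictlyGE a := by
    rintro ⟨a, _⟩ ⟨b, _⟩
    exact ⟨min (a - 1) b, CochainComplex.isStrictlyGE_mappingCone f a b _ (by simp) (by simp)⟩
  have le : (∃ a : ℤ, K.IsStrictlyLE a) → (∃ a : ℤ, L.IsStrictlyLE a) →
      ∃ a : ℤ, (CochainComplex.mappingCone f).IsStrictlyLE a := by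
    rintro ⟨a, _⟩ ⟨b, _⟩
    exact ⟨max (a - 1) b, isStrictlyLE_mappingCone f a b _ (by omega) (by omega)⟩
  cases s
  · trivial
  · exact ge hK hL
  · exact le hK hL
  · exact ⟨ge hK.1 hL.1, le hK.2 hL.2⟩

lemma Bound.complexes_shift (s : Bound) {K : CochainComplex C ℤ} (hK : s.complexes C K) (n : ℤ) :
    s.complexes C (K⟦n⟧) := by
  have ge : (∃ a : ℤ, K.IsStrictlyGE a) → ∃ a : ℤ, (K⟦n⟧).IsStrictlyGE a := by
    rintro ⟨a, _⟩
    exact ⟨a - n, K.isStrictlyGE_shift a n _ (by omega)⟩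
  have le : (∃ a : ℤ, K.IsStrictlyLE a) → ∃ a : ℤ, (K⟦n⟧).IsStrictlyLE a := by
    rintro ⟨a, _⟩
    exact ⟨a - n, K.isStrictlyLE_shift a n _ (by omega)⟩
  cases s
  · trivial
  · exact ge hK
  · exact le hK
  · exact ⟨ge hK.1, le hK.2⟩

lemma Bound.complexes_of_isZero (s : Bound) {K L : CochainComplex C ℤ} (hK : s.complexes C K)
    (h : ∀ i, IsZero (K.X i) → IsZero (L.X i)) : s.complexes C L := by
  have ge : (∃ a : ℤ, K.IsStrictlyGE a) → ∃ a : ℤ, L.IsStrictlyGE a := by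
    rintro ⟨a, _⟩
    exact ⟨a, (CochainComplex.isStrictlyGE_iff _ _).2
      fun i hi => h i (K.isZero_of_isStrictlyGE a i hi)⟩
  have le : (∃ a : ℤ, K.IsStrictlyLE a) → ∃ a : ℤ, L.IsStrictlyLE a := by
    rintro ⟨a, _⟩
    exact ⟨a, (CochainComplex.isStrictlyLE_iff _ _).2
      fun i hi => h i (K.isZero_of_isStrictlyLE a i hi)⟩
  cases s
  · trivial
  · exact ge hK
  · exact le hK
  · exact ⟨ge hK.1, le hK.2⟩

instance (s : Bound) : (s.objects C).ContainsZero where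
  exists_zero := ⟨(HomotopyCategory.quotient C (ComplexShape.up ℤ)).obj (stalkComplex 0),
    (HomotopyCategory.quotient C (ComplexShape.up ℤ)).map_isZero
      ((HomologicalComplex.single C (ComplexShape.up ℤ) 0).map_isZero (isZero_zero C)),
    stalkComplex_mem s 0⟩

instance (s : Bound) : (s.objects C).IsStableUnderShift ℤ where
  isStableUnderShiftBy n :=
    { le_shift := fun K hK => by
        obtain ⟨K : CochainComplex _ _, rfl⟩ := K.quotient_obj_surjective
        rw [ObjectProperty.prop_shift_iff, HomotopyCategory.shift_quotient_obj]
        exact s.complexes_shift hK n }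

/-- Strict boundedness is not invariant under homotopy equivalence, so the third object is only
isomorphic to a bounded complex, namely the mapping cone of a representative of the first morphism.
-/
instance (s : Bound) : (s.objects C).IsTriangulatedClosed₃ where
  ext₃' T hT h₁ h₂ := by
    obtain ⟨f : T.obj₁.as ⟶ T.obj₂.as, hf⟩ :=
      (HomotopyCategory.quotient C (ComplexShape.up ℤ)).map_surjective T.mor₁
    refine ⟨_, s.complexes_mappingCone f h₁ h₂,
      ⟨Triangle.π₃.mapIso (isoTriangleOfIso₁₂ T _ hT
        (HomotopyCategory.mappingCone_triangleh_distinguished f)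
        (Iso.refl _) (Iso.refl _) ?_)⟩⟩
    exact (Category.comp_id _).trans (hf.symm.trans (Category.id_comp _).symm)

instance (s : Bound) : (s.objects C).IsTriangulated where
  toIsTriangulatedClosed₂ := .of_isTriangulatedClosed₃

variable (C) in
/-- The acyclic complexes in `K^s(C)`. -/
abbrev acyclicK (s : Bound) : ObjectProperty (KCat C s) :=
  (HomotopyCategory.subcategoryAcyclic C).inverseImage (s.objects C).ι

variable (C) in
-- This presents the derived category as a Verdier quotient, which provides both calculi of
-- fractions.
lemma qis_eq_trW (s : Bound) : qis C s = (acyclicK C s).trW := by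
  ext X Y f
  rw [ObjectProperty.inverseImage_trW_iff, ← HomotopyCategory.quasiIso_eq_trW_subcategoryAcyclic]
  rfl

instance (s : Bound) : (qis C s).IsMultiplicative := by rw [qis_eq_trW]; infer_instance
instance (s : Bound) : (qis C s).RespectsIso := by rw [qis_eq_trW]; infer_instance
instance (s : Bound) : (qis C s).HasRightCalculusOfFractions := by
  rw [qis_eq_trW]; infer_instance
instance (s : Bound) : (qis C s).HasLeftCalculusOfFractions := by
  rw [qis_eq_trW]; infer_instance

instance : (HomotopyCategory.quasiIso C (ComplexShape.up ℤ)).HasTwoOutOfThreeProperty :=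
  { of_postcomp := fun f g hg hfg i => by
      have := hg i
      have h := hfg i
      rw [Functor.map_comp] at h
      exact IsIso.of_isIso_comp_right _ ((HomotopyCategory.homologyFunctor C _ i).map g)
    of_precomp := fun f g hf hfg i => by
      have := hf i
      have h := hfg i
      rw [Functor.map_comp] at h
      exact IsIso.of_isIso_comp_left ((HomotopyCategory.homologyFunctor C _ i).map f) _ }

end BoundedHomotopyCategory

end DReflexive

namespace DReflexive

open Pretriangulated

/-! ### Contravariant functors and quasi-isomorphisms of adapted complexes -/

section ShortExactSequences

variable {C : Type u} [Category.{v} C] [Abelian C]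

lemma quasiIso_g_of_acyclic {S : ShortComplex (CochainComplex C ℤ)} (hS : S.ShortExact)
    (h : S.X₁.Acyclic) : QuasiIso S.g where
  quasiIsoAt i := by
    rw [quasiIsoAt_iff_isIso_homologyMap]
    have hz (j : ℤ) : IsZero (S.X₁.homology j) :=
      (HomologicalComplex.exactAt_iff_isZero_homology _ _).1 (h j)
    have : Mono (HomologicalComplex.homologyMap S.g i) :=
      (hS.homology_exact₂ i).mono_g ((hz i).eq_of_src _ _)
    have : Epi (HomologicalComplex.homologyMap S.g i) :=
      (hS.homology_exact₃ i (i + 1) rfl).epi_f ((hz _).eq_of_tgt _ _)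
    exact isIso_of_mono_of_epi _

end ShortExactSequences

section Contravariant

variable {𝒜 : Type u₁} [Category.{v₁} 𝒜] [Abelian 𝒜] {ℬ : Type u₂} [Category.{v₂} ℬ] [Abelian ℬ]
  (F : 𝒜ᵒᵖ ⥤ ℬ) [F.Additive]

lemma onHomotopy_map_quotient {X Y : CochainComplex 𝒜 ℤ} (f : X ⟶ Y) :
    (onHomotopy F).map ((HomotopyCategory.quotient 𝒜 (ComplexShape.up ℤ)).map f).op =
      (HomotopyCategory.quotient ℬ (ComplexShape.up ℤ)).map ((onComplexes F).map f.op) := rfl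

/-- The image under a contravariant functor of a sequence of complexes. -/
def mapSequence (S : ShortComplex (CochainComplex 𝒜 ℤ)) :
    ShortComplex (CochainComplex ℬ ℤ) :=
  ShortComplex.mk ((onComplexes F).map S.g.op) ((onComplexes F).map S.f.op) (by
    ext i
    refine (F.map_comp _ _).symm.trans ?_
    have h : S.f.f (-i) ≫ S.g.f (-i) = 0 := by
      rw [← HomologicalComplex.comp_f, S.zero, HomologicalComplex.zero_f]
    exact (congrArg (fun k => F.map k.op) h).trans (F.map_zero _ _))

lemma mapSequence_shortExact {S : ShortComplex (CochainComplex 𝒜 ℤ)}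
    (σ : ∀ n, (S.map (HomologicalComplex.eval 𝒜 _ n)).Splitting) :
    (mapSequence F S).ShortExact :=
  HomologicalComplex.shortExact_of_degreewise_shortExact _
    fun i => ((σ (-i)).op.map F).shortExact

namespace IsAdapted

variable {F} {s : Bound} {S : ObjectProperty (HomotopyCategory 𝒜 (ComplexShape.up ℤ))}

/-- The cone of `g` is exact and, up to isomorphism, in `S`, so `F` keeps it exact. The triangle of
`g` comes from a degreewise split sequence of complexes. An additive functor preserves such
sequences, so no triangulated structure on the contravariant extension is needed. -/
lemma quasiIso_map (hS : IsAdapted F s S) {X Y : HomotopyCategory 𝒜 (ComplexShape.up ℤ)}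
    (g : X ⟶ Y) (hX : S.isoClosure X) (hY : S.isoClosure Y)
    (hg : HomotopyCategory.quasiIso 𝒜 (ComplexShape.up ℤ) g) :
    HomotopyCategory.quasiIso ℬ (ComplexShape.up ℤ) ((onHomotopy F).map g.op) := by
  have := hS.isTriangulated
  obtain ⟨Z, ⟨Z₀, hZ₀, ⟨e₀⟩⟩, a, b, hT⟩ := S.isoClosure.distinguished_cocone_triangle g hX hY
  have hZ' : HomotopyCategory.subcategoryAcyclic 𝒜 Z := by
    rw [HomotopyCategory.quasiIso_eq_trW_subcategoryAcyclic] at hg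
    exact (ObjectProperty.trW_iff_of_distinguished _ _ hT).1 hg
  have hFZ : HomotopyCategory.subcategoryAcyclic ℬ ((onHomotopy F).obj (op Z₀)) :=
    (HomotopyCategory.quotient_obj_mem_subcategoryAcyclic_iff_acyclic _).2
      (hS.map_exact Z₀.as hZ₀
        ((HomotopyCategory.quotient_obj_mem_subcategoryAcyclic_iff_acyclic Z₀.as).1
          ((HomotopyCategory.subcategoryAcyclic 𝒜).prop_of_iso e₀ hZ')))
  obtain ⟨U, σ, ⟨e⟩⟩ :=
    (HomotopyCategory.distinguished_iff_iso_trianglehOfDegreewiseSplit _).1 hT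
  let e₃ : Z₀ ≅ (HomotopyCategory.quotient 𝒜 (ComplexShape.up ℤ)).obj U.X₃ :=
    e₀.symm ≪≫ Triangle.π₃.mapIso e
  have hU : ((onComplexes F).obj (op U.X₃)).Acyclic :=
    (HomotopyCategory.quotient_obj_mem_subcategoryAcyclic_iff_acyclic _).1
      ((HomotopyCategory.subcategoryAcyclic ℬ).prop_of_iso ((onHomotopy F).mapIso e₃.symm.op) hFZ)
  have hq : QuasiIso (mapSequence F U).g :=
    quasiIso_g_of_acyclic (mapSequence_shortExact F σ) hU
  have hq' : HomotopyCategory.quasiIso ℬ (ComplexShape.up ℤ) ((onHomotopy F).map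
      ((HomotopyCategory.quotient 𝒜 (ComplexShape.up ℤ)).map U.f).op) := by
    rw [onHomotopy_map_quotient]
    exact (HomotopyCategory.quotient_map_mem_quasiIso_iff _).2 hq
  let e' : Arrow.mk ((HomotopyCategory.quotient 𝒜 (ComplexShape.up ℤ)).map U.f).op ≅
      Arrow.mk g.op :=
    Arrow.isoMk (Triangle.π₂.mapIso e).op (Triangle.π₁.mapIso e).op
      (Quiver.Hom.unop_inj e.hom.comm₁)
  exact ((HomotopyCategory.quasiIso ℬ (ComplexShape.up ℤ)).arrow_mk_iso_iff
    ((onHomotopy F).mapArrow.mapIso e')).1 hq'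

end IsAdapted

end Contravariant

end DReflexive

namespace DReflexive

open Pretriangulated

/-! ### Resolutions by a triangulated subcategory give a derivability structure -/

section Derivability

variable {C : Type u} [Category.{v} C] [HasZeroObject C] [HasShift C ℤ] [Preadditive C]
  [∀ n : ℤ, (shiftFunctor C n).Additive] [Pretriangulated C] [IsTriangulated C]
  {A B : ObjectProperty C} [A.IsTriangulated] [B.IsTriangulated] [B.IsClosedUnderIsomorphisms]

omit [IsTriangulated C] [B.IsTriangulated] in
-- A cone of `f` chosen in `A` also lies in `B`, since membership in `B` does not depend on the
-- choice of cone.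
lemma trW_inf_of_trW {X Y : C} (f : X ⟶ Y) (hX : A X) (hY : A Y) (hf : B.trW f) :
    (A ⊓ B).trW f := by
  obtain ⟨Z, hZ, a, b, hT⟩ := A.distinguished_cocone_triangle f hX hY
  exact ⟨Z, a, b, hT, hZ, (B.trW_iff_of_distinguished _ hT).1 hf⟩

variable (hres : ∀ X : C, ∃ (P : C) (f : P ⟶ X), A P ∧ B.trW f)
include hres

lemma isVerdierLeftLocalizing_of_resolutions : A.IsVerdierLeftLocalizing B := by
  rw [ObjectProperty.isVerdierLeftLocalizing_iff]
  intro X Y f hY hf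
  obtain ⟨P, p, hP, hp⟩ := hres X
  exact ⟨P, p ≫ f, p, hP, trW_inf_of_trW _ hP hY (B.trW.comp_mem _ _ hp hf), rfl⟩

omit [IsTriangulated C] [B.IsTriangulated] [B.IsClosedUnderIsomorphisms] in
lemma hasLeftResolutions_of_resolutions :
    (A.triangulatedLocalizerMorphism B).HasLeftResolutions := fun X => by
  obtain ⟨P, p, hP, hp⟩ := hres X
  exact ⟨{ X₁ := ⟨P, hP⟩, w := p, hw := hp }⟩

omit [A.IsTriangulated] [B.IsClosedUnderIsomorphisms] in
-- The Ore condition completes the square, and its new corner is then resolved.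
lemma exists_resolution_of_span {X Y Z : C} (f : X ⟶ Z) (g : Y ⟶ Z) (hg : B.trW g) :
    ∃ (P : C) (a : P ⟶ X) (b : P ⟶ Y), A P ∧ B.trW a ∧ a ≫ f = b ≫ g := by
  obtain ⟨φ, hφ⟩ := (MorphismProperty.LeftFraction.mk f g hg).exists_rightFraction
  obtain ⟨P, p, hP, hp⟩ := hres φ.X'
  exact ⟨P, p ≫ φ.s, p ≫ φ.f, hP, B.trW.comp_mem _ _ hp φ.hs, by
    simpa using congrArg (fun k => p ≫ k) hφ⟩

omit [B.IsClosedUnderIsomorphisms] in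
lemma hasLeftResolutions_arrow_of_resolutions :
    (A.triangulatedLocalizerMorphism B).arrow.HasLeftResolutions := fun f => by
  obtain ⟨P, p, hP, hp⟩ := hres f.right
  obtain ⟨P', a, b, hP', ha, hab⟩ := exists_resolution_of_span hres f.hom p hp
  exact ⟨{
    X₁ := Arrow.mk (A.homMk b : (⟨P', hP'⟩ : A.FullSubcategory) ⟶ ⟨P, hP⟩)
    w := Arrow.homMk a p hab
    hw := ⟨ha, hp⟩ }⟩

omit [B.IsClosedUnderIsomorphisms] in
-- Any two resolutions of `X` are dominated by a third one.
lemma isConnected_leftResolution_of_resolutions (X : C) :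
    IsConnected ((A.triangulatedLocalizerMorphism B).LeftResolution X) := by
  have : Nonempty ((A.triangulatedLocalizerMorphism B).LeftResolution X) :=
    hasLeftResolutions_of_resolutions hres X
  refine zigzag_isConnected fun R R' => ?_
  obtain ⟨P, a, b, hP, ha, hab⟩ := exists_resolution_of_span hres R.w R'.w R'.hw
  let R'' : (A.triangulatedLocalizerMorphism B).LeftResolution X :=
    { X₁ := ⟨P, hP⟩, w := a ≫ R.w, hw := B.trW.comp_mem _ _ ha R.hw }
  let φ : R'' ⟶ R := { f := A.homMk a, comm := rfl }
  let φ' : R'' ⟶ R' := { f := A.homMk b, comm := hab.symm }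
  exact (Zigzag.of_inv φ).trans (Zigzag.of_hom φ')

/-- Full faithfulness comes from the Verdier localizing property, essential surjectivity from the
resolutions. -/
lemma isLocalizedEquivalence_of_resolutions :
    (A.triangulatedLocalizerMorphism B).IsLocalizedEquivalence := by
  have := isVerdierLeftLocalizing_of_resolutions hres
  have := hasLeftResolutions_of_resolutions hres
  let L₁ := (B.inverseImage A.ι).trW.Q
  let L₂ := B.trW.Q
  let G := (A.triangulatedLocalizerMorphism B).localizedFunctor L₁ L₂
  have : (L₁ ⋙ G).EssSurj := by
    have := (A.triangulatedLocalizerMorphism B).essSurj_of_hasLeftResolutions L₂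
    exact Functor.essSurj_of_iso
      (CatCommSq.iso (A.triangulatedLocalizerMorphism B).functor L₁ L₂ G)
  have : G.EssSurj := ⟨fun Y => by
    obtain ⟨X, ⟨e⟩⟩ := Functor.EssSurj.mem_essImage (F := L₁ ⋙ G) Y
    exact ⟨L₁.obj X, ⟨e⟩⟩⟩
  have : G.IsEquivalence := { }
  exact LocalizerMorphism.IsLocalizedEquivalence.mk' _ L₁ L₂ G

theorem isLeftDerivabilityStructure_of_resolutions :
    (A.triangulatedLocalizerMorphism B).IsLeftDerivabilityStructure := by
  have := isLocalizedEquivalence_of_resolutions hres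
  have := hasLeftResolutions_arrow_of_resolutions hres
  have := isConnected_leftResolution_of_resolutions hres
  exact LocalizerMorphism.IsLeftDerivabilityStructure.mk' _

end Derivability

/-! ### Adapted complexes compute the derived functor -/

section DerivedFunctors

variable {𝒜 : Type u₁} [Category.{v₁} 𝒜] [Abelian 𝒜] {ℬ : Type u₂} [Category.{v₂} ℬ] [Abelian ℬ]
  {F : 𝒜ᵒᵖ ⥤ ℬ} [F.Additive] {s t : Bound}
  {S : ObjectProperty (HomotopyCategory 𝒜 (ComplexShape.up ℤ))}

namespace IsAdapted

variable (hS : IsAdapted F s S)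
include hS

lemma isTriangulated_inverseImage :
    (S.isoClosure.inverseImage (s.objects 𝒜).ι).IsTriangulated := by
  have := hS.isTriangulated
  infer_instance

lemma exists_resolutionK (X : KCat 𝒜 s) : ∃ (P : KCat 𝒜 s) (f : P ⟶ X), S P.obj ∧ qis 𝒜 s f := by
  obtain ⟨P, f, hP, hf⟩ := hS.exists_resolution X.obj X.property
  exact ⟨⟨P, hS.le_objects _ hP⟩, ObjectProperty.homMk f, hP, hf⟩

lemma exists_resolution_isoClosure (X : KCat 𝒜 s) : ∃ (P : KCat 𝒜 s) (f : P ⟶ X),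
    S.isoClosure.inverseImage (s.objects 𝒜).ι P ∧ (acyclicK 𝒜 s).trW f := by
  obtain ⟨P, f, hP, hf⟩ := hS.exists_resolutionK X
  exact ⟨P, f, S.le_isoClosure _ hP, qis_eq_trW 𝒜 s ▸ hf⟩

lemma exists_resolution_of_spanK {X Y Z : KCat 𝒜 s} (f : X ⟶ Z) (g : Y ⟶ Z) (hg : qis 𝒜 s g) :
    ∃ (P : KCat 𝒜 s) (a : P ⟶ X) (b : P ⟶ Y), S P.obj ∧ qis 𝒜 s a ∧ a ≫ f = b ≫ g := by
  have := hS.isTriangulated_inverseImage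
  obtain ⟨X', a, b, hX', ha, hab⟩ : ∃ (X' : KCat 𝒜 s) (a : X' ⟶ X) (b : X' ⟶ Y),
      S.isoClosure X'.obj ∧ qis 𝒜 s a ∧ a ≫ f = b ≫ g := by
    rw [qis_eq_trW] at hg ⊢
    exact exists_resolution_of_span (A := S.isoClosure.inverseImage (s.objects 𝒜).ι)
      hS.exists_resolution_isoClosure f g hg
  -- The corner `X'` is only known to be isomorphic to an object of `S`; resolving once more lands
  -- in `S` itself.
  obtain ⟨P, p, hP, hp⟩ := hS.exists_resolutionK X'
  exact ⟨P, p ≫ a, p ≫ b, hP, (qis 𝒜 s).comp_mem _ _ hp ha, by simp [hab]⟩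

/-- The universal property in `IsDerived` does not say what `RF` is on objects. The derivability
structure does: `F` inverts quasi-isomorphisms between adapted complexes, hence agrees with `RF` on
them. -/
theorem isIso_of_isDerived (h : MapsBound F s t) (RF : (DCat 𝒜 s)ᵒᵖ ⥤ DCat ℬ t)
    (α : onK F h ⋙ locQ ℬ t ⟶ (locQ 𝒜 s).op ⋙ RF) (hRF : IsDerived F h RF α)
    (P : KCat 𝒜 s) (hP : S P.obj) : IsIso (α.app (op P)) := by
  have := hS.isTriangulated_inverseImage
  let L := (S.isoClosure.inverseImage (s.objects 𝒜).ι).triangulatedLocalizerMorphism (acyclicK 𝒜 s)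
  have : L.IsLeftDerivabilityStructure :=
    isLeftDerivabilityStructure_of_resolutions hS.exists_resolution_isoClosure
  have hder : L.op.Derives (onK F h ⋙ locQ ℬ t) := by
    intro X Y f hf
    have hf' : qis 𝒜 s f.unop.hom := (qis_eq_trW 𝒜 s).symm ▸ L.map _ hf
    exact Localization.inverts (locQ ℬ t) (qis ℬ t) _
      (hS.quasiIso_map _ Y.unop.property X.unop.property hf')
  have : (locQ 𝒜 s).op.IsLocalization (acyclicK 𝒜 s).trW.op := by
    rw [← qis_eq_trW]; infer_instance
  have : RF.IsRightDerivedFunctor α (acyclicK 𝒜 s).trW.op := by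
    rw [Functor.isRightDerivedFunctor_iff_isLeftKanExtension]
    exact hRF.isLeftKanExtension
  exact hder.isIso_of_isRightDerivedFunctor α (op ⟨P, S.le_isoClosure _ hP⟩)

end IsAdapted

end DerivedFunctors

end DReflexive

namespace DReflexive

open Pretriangulated

/-! ### Termwise transformations as morphisms of triangles -/

section TermwiseTransformation

variable {C : Type u} [Category.{v} C] [Abelian C] {T : C ⥤ C} [T.Additive] (η : 𝟭 C ⟶ T)

/-- The termwise extension of `η : 𝟭 C ⟶ T` to complexes. -/
@[simps]
def termwise : 𝟭 (CochainComplex C ℤ) ⟶ T.mapHomologicalComplex (ComplexShape.up ℤ) where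
  app X :=
    { f := fun i => η.app (X.X i)
      comm' := fun i j _ => (η.naturality (X.d i j)).symm }
  naturality X Y f := by
    ext i
    exact η.naturality (f.f i)

/-- The termwise extension of `η : 𝟭 C ⟶ T` to the homotopy category. -/
def termwiseK : 𝟭 (HomotopyCategory C (ComplexShape.up ℤ)) ⟶
    T.mapHomotopyCategory (ComplexShape.up ℤ) where
  app X := (HomotopyCategory.quotient C (ComplexShape.up ℤ)).map ((termwise η).app X.as)
  naturality X Y f := by
    obtain ⟨f : X.as ⟶ Y.as, rfl⟩ :=
      (HomotopyCategory.quotient C (ComplexShape.up ℤ)).map_surjective f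
    exact congrArg (HomotopyCategory.quotient C (ComplexShape.up ℤ)).map
      ((termwise η).naturality f)

/-- In each degree the commutation of `T` with the shift is an identity morphism. -/
lemma termwise_app_shift (X : CochainComplex C ℤ) (n : ℤ) :
    ((termwise η).app X)⟦n⟧' = (termwise η).app (X⟦n⟧) ≫
      ((T.mapHomologicalComplex (ComplexShape.up ℤ)).commShiftIso n).hom.app X := by
  ext i
  exact (Category.comp_id _).symm

lemma termwiseK_app_shift (X : HomotopyCategory C (ComplexShape.up ℤ)) (n : ℤ) :
    ((termwiseK η).app X)⟦n⟧' = (termwiseK η).app (X⟦n⟧) ≫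
      ((T.mapHomotopyCategory (ComplexShape.up ℤ)).commShiftIso n).hom.app X := by
  obtain ⟨X, rfl⟩ := HomotopyCategory.quotient_obj_surjective X
  have h₁ := ((HomotopyCategory.quotient C (ComplexShape.up ℤ)).commShiftIso n).hom.naturality
    ((termwise η).app X)
  have h₂ := NatTrans.shift_app_comm
    (T.mapHomotopyCategoryFactors (ComplexShape.up ℤ)).hom n X
  have h₃ := (termwiseK η).naturality
    (((HomotopyCategory.quotient C (ComplexShape.up ℤ)).commShiftIso n).hom.app X)
  have h₄ : (T.mapHomotopyCategory (ComplexShape.up ℤ)).map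
        (((HomotopyCategory.quotient C (ComplexShape.up ℤ)).commShiftIso n).hom.app X) ≫
      ((T.mapHomotopyCategory (ComplexShape.up ℤ)).commShiftIso n).hom.app
        ((HomotopyCategory.quotient C (ComplexShape.up ℤ)).obj X) =
      (HomotopyCategory.quotient C (ComplexShape.up ℤ)).map
        (((T.mapHomologicalComplex (ComplexShape.up ℤ)).commShiftIso n).hom.app X) ≫
      ((HomotopyCategory.quotient C (ComplexShape.up ℤ)).commShiftIso n).hom.app
        ((T.mapHomologicalComplex (ComplexShape.up ℤ)).obj X) := by
    rw [Functor.commShiftIso_comp_hom_app, Functor.commShiftIso_comp_hom_app] at h₂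
    refine Eq.trans ?_ (h₂.trans (Category.id_comp _))
    symm
    refine (congrArg (fun k => _ ≫ k) (CategoryTheory.Functor.map_id _ _)).trans (Category.comp_id _)
  rw [← cancel_epi
    (((HomotopyCategory.quotient C (ComplexShape.up ℤ)).commShiftIso n).hom.app X)]
  refine h₁.symm.trans ?_
  refine (congrArg (fun k => (HomotopyCategory.quotient C (ComplexShape.up ℤ)).map k ≫ _)
    (termwise_app_shift η X n)).trans ?_
  rw [Functor.map_comp, Category.assoc]
  refine (congrArg (fun k => _ ≫ k) h₄.symm).trans ?_
  refine (Category.assoc _ _ _).symm.trans (Eq.trans ?_ (Category.assoc _ _ _))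
  exact congrArg (fun k => k ≫ ((T.mapHomotopyCategory (ComplexShape.up ℤ)).commShiftIso n).hom.app
    ((HomotopyCategory.quotient C (ComplexShape.up ℤ)).obj X)) h₃.symm

/-- The morphism of triangles given by the termwise extension of `η : 𝟭 C ⟶ T`. -/
@[simps]
def termwiseTriangle (X : Triangle (HomotopyCategory C (ComplexShape.up ℤ))) :
    X ⟶ (T.mapHomotopyCategory (ComplexShape.up ℤ)).mapTriangle.obj X where
  hom₁ := (termwiseK η).app X.obj₁
  hom₂ := (termwiseK η).app X.obj₂
  hom₃ := (termwiseK η).app X.obj₃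
  comm₁ := (termwiseK η).naturality X.mor₁
  comm₂ := (termwiseK η).naturality X.mor₂
  comm₃ := by
    have h := (termwiseK η).naturality X.mor₃
    refine (congrArg (fun k => X.mor₃ ≫ k) (termwiseK_app_shift η X.obj₁ 1)).trans ?_
    refine (Category.assoc _ _ _).symm.trans (Eq.trans ?_ (Category.assoc _ _ _))
    exact congrArg (fun k => k ≫ ((T.mapHomotopyCategory (ComplexShape.up ℤ)).commShiftIso 1).hom.app
      X.obj₁) h

end TermwiseTransformation

end DReflexive

namespace DReflexive

open Pretriangulated ComposableArrows

/-! ### Four lemmas for morphisms of distinguished triangles -/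

section HomologySequence

variable {C A : Type*} [Category* C] [Category* A] [HasZeroObject C] [HasShift C ℤ] [Preadditive C]
  [∀ n : ℤ, (shiftFunctor C n).Additive] [Pretriangulated C] [Abelian A]
  (F : C ⥤ A) [F.IsHomological] [F.ShiftSequence ℤ] {T T' : Triangle C}
  (hT : T ∈ distTriang C) (hT' : T' ∈ distTriang C) (φ : T ⟶ T')

/-- The morphism of homology sequences induced by a morphism of triangles. -/
noncomputable def homologySequenceMap (n₀ n₁ : ℤ) (h : n₀ + 1 = n₁) :
    F.homologySequenceComposableArrows₅ T n₀ n₁ h ⟶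
      F.homologySequenceComposableArrows₅ T' n₀ n₁ h :=
  homMk₅ ((F.shift n₀).map φ.hom₁) ((F.shift n₀).map φ.hom₂) ((F.shift n₀).map φ.hom₃)
    ((F.shift n₁).map φ.hom₁) ((F.shift n₁).map φ.hom₂) ((F.shift n₁).map φ.hom₃)
    (((F.shift n₀).map_comp _ _).symm.trans
      ((congrArg _ φ.comm₁).trans ((F.shift n₀).map_comp _ _)))
    (((F.shift n₀).map_comp _ _).symm.trans
      ((congrArg _ φ.comm₂).trans ((F.shift n₀).map_comp _ _)))
    (F.homologySequenceδ_naturality T T' φ n₀ n₁ h).symm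
    (((F.shift n₁).map_comp _ _).symm.trans
      ((congrArg _ φ.comm₁).trans ((F.shift n₁).map_comp _ _)))
    (((F.shift n₁).map_comp _ _).symm.trans
      ((congrArg _ φ.comm₂).trans ((F.shift n₁).map_comp _ _)))

include hT hT'

/-- This and the next five lemmas apply the two four lemmas to the three windows of the six-term
sequence; `k` is the position of the window. -/
lemma epi_shift_map_hom₂ (n₀ n₁ : ℤ) (h : n₀ + 1 = n₁) (h₁ : Epi ((F.shift n₀).map φ.hom₁))
    (h₃ : Epi ((F.shift n₀).map φ.hom₃)) (h₁' : Mono ((F.shift n₁).map φ.hom₁)) :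
    Epi ((F.shift n₀).map φ.hom₂) :=
  Abelian.epi_of_epi_of_epi_of_mono'' (k := 0) (by lia)
    (F.homologySequenceComposableArrows₅_exact T hT n₀ n₁ h)
    (F.homologySequenceComposableArrows₅_exact T' hT' n₀ n₁ h)
    (homologySequenceMap F φ n₀ n₁ h) 0 1 2 3 rfl rfl rfl rfl h₁ h₃ h₁'

lemma epi_shift_map_hom₃ (n₀ n₁ : ℤ) (h : n₀ + 1 = n₁) (h₂ : Epi ((F.shift n₀).map φ.hom₂))
    (h₁ : Epi ((F.shift n₁).map φ.hom₁)) (h₂' : Mono ((F.shift n₁).map φ.hom₂)) :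
    Epi ((F.shift n₀).map φ.hom₃) :=
  Abelian.epi_of_epi_of_epi_of_mono'' (k := 1) (by lia)
    (F.homologySequenceComposableArrows₅_exact T hT n₀ n₁ h)
    (F.homologySequenceComposableArrows₅_exact T' hT' n₀ n₁ h)
    (homologySequenceMap F φ n₀ n₁ h) 1 2 3 4 rfl rfl rfl rfl h₂ h₁ h₂'

lemma epi_shift_map_hom₁ (n₀ n₁ : ℤ) (h : n₀ + 1 = n₁) (h₃ : Epi ((F.shift n₀).map φ.hom₃))
    (h₂ : Epi ((F.shift n₁).map φ.hom₂)) (h₃' : Mono ((F.shift n₁).map φ.hom₃)) :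
    Epi ((F.shift n₁).map φ.hom₁) :=
  Abelian.epi_of_epi_of_epi_of_mono'' (k := 2) (by lia)
    (F.homologySequenceComposableArrows₅_exact T hT n₀ n₁ h)
    (F.homologySequenceComposableArrows₅_exact T' hT' n₀ n₁ h)
    (homologySequenceMap F φ n₀ n₁ h) 2 3 4 5 rfl rfl rfl rfl h₃ h₂ h₃'

lemma mono_shift_map_hom₃ (n₀ n₁ : ℤ) (h : n₀ + 1 = n₁) (h₁ : Epi ((F.shift n₀).map φ.hom₁))
    (h₂ : Mono ((F.shift n₀).map φ.hom₂)) (h₁' : Mono ((F.shift n₁).map φ.hom₁)) :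
    Mono ((F.shift n₀).map φ.hom₃) :=
  Abelian.mono_of_epi_of_mono_of_mono'' (k := 0) (by lia)
    (F.homologySequenceComposableArrows₅_exact T hT n₀ n₁ h)
    (F.homologySequenceComposableArrows₅_exact T' hT' n₀ n₁ h)
    (homologySequenceMap F φ n₀ n₁ h) 0 1 2 3 rfl rfl rfl rfl h₁ h₂ h₁'

lemma mono_shift_map_hom₁ (n₀ n₁ : ℤ) (h : n₀ + 1 = n₁) (h₂ : Epi ((F.shift n₀).map φ.hom₂))
    (h₃ : Mono ((F.shift n₀).map φ.hom₃)) (h₂' : Mono ((F.shift n₁).map φ.hom₂)) :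
    Mono ((F.shift n₁).map φ.hom₁) :=
  Abelian.mono_of_epi_of_mono_of_mono'' (k := 1) (by lia)
    (F.homologySequenceComposableArrows₅_exact T hT n₀ n₁ h)
    (F.homologySequenceComposableArrows₅_exact T' hT' n₀ n₁ h)
    (homologySequenceMap F φ n₀ n₁ h) 1 2 3 4 rfl rfl rfl rfl h₂ h₃ h₂'

lemma mono_shift_map_hom₂ (n₀ n₁ : ℤ) (h : n₀ + 1 = n₁) (h₃ : Epi ((F.shift n₀).map φ.hom₃))
    (h₁ : Mono ((F.shift n₁).map φ.hom₁)) (h₃' : Mono ((F.shift n₁).map φ.hom₃)) :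
    Mono ((F.shift n₁).map φ.hom₂) :=
  Abelian.mono_of_epi_of_mono_of_mono'' (k := 2) (by lia)
    (F.homologySequenceComposableArrows₅_exact T hT n₀ n₁ h)
    (F.homologySequenceComposableArrows₅_exact T' hT' n₀ n₁ h)
    (homologySequenceMap F φ n₀ n₁ h) 2 3 4 5 rfl rfl rfl rfl h₃ h₁ h₃'

end HomologySequence

/-! ### Vanishing of the cohomology of a cone in one degree -/

section QuasiIso

variable {C : Type u} [Category.{v} C] [Abelian C]

/-- The morphism `f` is surjective on `H^j` and injective on `H^{j+1}`, that is, the cohomology of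
its cone vanishes in degree `j`. -/
def IsoAt (j : ℤ) {X Y : HomotopyCategory C (ComplexShape.up ℤ)} (f : X ⟶ Y) : Prop :=
  Epi ((HomotopyCategory.homologyFunctor C (ComplexShape.up ℤ) j).map f) ∧
    Mono ((HomotopyCategory.homologyFunctor C (ComplexShape.up ℤ) (j + 1)).map f)

lemma quasiIso_iff_isoAt {X Y : HomotopyCategory C (ComplexShape.up ℤ)} (f : X ⟶ Y) :
    HomotopyCategory.quasiIso C (ComplexShape.up ℤ) f ↔ ∀ j : ℤ, IsoAt j f := by
  constructor
  · intro h j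
    have h₀ := h j
    have h₁ := h (j + 1)
    exact ⟨IsIso.epi_of_iso _, IsIso.mono_of_iso _⟩
  · intro h j
    have h₀ := (h j).1
    have h₁ := (h (j - 1)).2
    rw [sub_add_cancel] at h₁
    exact isIso_of_mono_of_epi _

lemma isoAt_comp_iff {X Y Z : HomotopyCategory C (ComplexShape.up ℤ)} (f : X ⟶ Y) (g : Y ⟶ Z)
    (hg : HomotopyCategory.quasiIso C (ComplexShape.up ℤ) g) (j : ℤ) :
    IsoAt j (f ≫ g) ↔ IsoAt j f := by
  have h₀ := hg j
  have h₁ := hg (j + 1)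
  simp only [IsoAt, Functor.map_comp]
  exact and_congr ((MorphismProperty.epimorphisms _).cancel_right_of_respectsIso _ _)
    ((MorphismProperty.monomorphisms _).cancel_right_of_respectsIso _ _)

lemma isoAt_precomp_iff {X Y Z : HomotopyCategory C (ComplexShape.up ℤ)} (f : X ⟶ Y) (g : Y ⟶ Z)
    (hf : HomotopyCategory.quasiIso C (ComplexShape.up ℤ) f) (j : ℤ) :
    IsoAt j (f ≫ g) ↔ IsoAt j g := by
  have h₀ := hf j
  have h₁ := hf (j + 1)
  simp only [IsoAt, Functor.map_comp]
  exact and_congr ((MorphismProperty.epimorphisms _).cancel_left_of_respectsIso _ _)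
    ((MorphismProperty.monomorphisms _).cancel_left_of_respectsIso _ _)

variable {T T' : Triangle (HomotopyCategory C (ComplexShape.up ℤ))}
  (hT : T ∈ distTriang _) (hT' : T' ∈ distTriang _) (φ : T ⟶ T')
include hT hT'

/-- The cones of the three vertical maps would form a triangle with acyclic middle term, so the
third is the shift of the first. Only four lemmas are used, which avoids constructing that triangle.
-/
lemma isoAt_hom₃_iff (h₂ : HomotopyCategory.quasiIso C (ComplexShape.up ℤ) φ.hom₂) (j : ℤ) :
    IsoAt j φ.hom₃ ↔ IsoAt (j + 1) φ.hom₁ := by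
  let H := HomotopyCategory.homologyFunctor C (ComplexShape.up ℤ) 0
  have h (i : ℤ) : IsIso ((H.shift i).map φ.hom₂) := h₂ i
  constructor
  · rintro ⟨he, hm⟩
    exact ⟨epi_shift_map_hom₁ H hT hT' φ j _ rfl he inferInstance hm,
      mono_shift_map_hom₁ H hT hT' φ (j + 1) _ rfl inferInstance hm inferInstance⟩
  · rintro ⟨he, hm⟩
    exact ⟨epi_shift_map_hom₃ H hT hT' φ j _ rfl inferInstance he inferInstance,
      mono_shift_map_hom₃ H hT hT' φ (j + 1) _ rfl he inferInstance hm⟩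

lemma quasiIso_hom₂ (h₁ : HomotopyCategory.quasiIso C (ComplexShape.up ℤ) φ.hom₁)
    (h₃ : HomotopyCategory.quasiIso C (ComplexShape.up ℤ) φ.hom₃) :
    HomotopyCategory.quasiIso C (ComplexShape.up ℤ) φ.hom₂ := by
  let H := HomotopyCategory.homologyFunctor C (ComplexShape.up ℤ) 0
  have h (i : ℤ) : IsIso ((H.shift i).map φ.hom₁) := h₁ i
  have h' (i : ℤ) : IsIso ((H.shift i).map φ.hom₃) := h₃ i
  exact (quasiIso_iff_isoAt _).2 fun j =>
    ⟨epi_shift_map_hom₂ H hT hT' φ j _ rfl inferInstance inferInstance inferInstance,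
      mono_shift_map_hom₂ H hT hT' φ j _ rfl inferInstance inferInstance inferInstance⟩

lemma quasiIso_hom₃ (h₁ : HomotopyCategory.quasiIso C (ComplexShape.up ℤ) φ.hom₁)
    (h₂ : HomotopyCategory.quasiIso C (ComplexShape.up ℤ) φ.hom₂) :
    HomotopyCategory.quasiIso C (ComplexShape.up ℤ) φ.hom₃ := by
  let H := HomotopyCategory.homologyFunctor C (ComplexShape.up ℤ) 0
  have h (i : ℤ) : IsIso ((H.shift i).map φ.hom₁) := h₁ i
  have h' (i : ℤ) : IsIso ((H.shift i).map φ.hom₂) := h₂ i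
  exact (quasiIso_iff_isoAt _).2 fun j =>
    ⟨epi_shift_map_hom₃ H hT hT' φ j _ rfl inferInstance inferInstance inferInstance,
      mono_shift_map_hom₃ H hT hT' φ (j + 1) _ rfl inferInstance inferInstance inferInstance⟩

end QuasiIso

end DReflexive

namespace DReflexive

/-! ### The derived unit as the termwise unit of a resolution -/

section Contravariant

variable {𝒜 : Type u₁} [Category.{v₁} 𝒜] [Abelian 𝒜] {ℬ : Type u₂} [Category.{v₂} ℬ] [Abelian ℬ]

/-- Quasi-isomorphisms are saturated because cohomology factors through the localization. -/
lemma isIso_locQ_map_iff (s : Bound) {X Y : KCat 𝒜 s} (f : X ⟶ Y) :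
    IsIso ((locQ 𝒜 s).map f) ↔ qis 𝒜 s f := by
  refine ⟨fun _ i => ?_, fun h => Localization.inverts (locQ 𝒜 s) (qis 𝒜 s) f h⟩
  have e : locQ 𝒜 s ⋙ cohomology 𝒜 s i =
      (s.objects 𝒜).ι ⋙ HomotopyCategory.homologyFunctor 𝒜 (ComplexShape.up ℤ) i :=
    Localization.Construction.fac _ _
  exact (NatIso.isIso_map_iff (eqToIso e) f).1
    (inferInstanceAs (IsIso ((cohomology 𝒜 s i).map ((locQ 𝒜 s).map f))))

/-- The cohomology of an object of the homotopy category can be computed in the derived category. -/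
noncomputable def cohomologyIso (s : Bound) (i : ℤ) (X : KCat 𝒜 s) :
    (cohomology 𝒜 s i).obj ((locQ 𝒜 s).obj X) ≅
      (HomotopyCategory.homologyFunctor 𝒜 (ComplexShape.up ℤ) i).obj X.obj :=
  (eqToIso (Localization.Construction.fac _ _ : locQ 𝒜 s ⋙ cohomology 𝒜 s i =
      (s.objects 𝒜).ι ⋙ HomotopyCategory.homologyFunctor 𝒜 (ComplexShape.up ℤ) i)).app X

variable {Φ : 𝒜ᵒᵖ ⥤ ℬ} {Ψ : ℬᵒᵖ ⥤ 𝒜} [Φ.Additive] [Ψ.Additive]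

variable (Φ Ψ) in
/-- The covariant functor `Ψ Φ`. -/
abbrev bidual : 𝒜 ⥤ 𝒜 := Φ.rightOp ⋙ Ψ

instance : (bidual Φ Ψ).Additive := inferInstance

variable (Φ Ψ) in
/-- The termwise extension of `Ψ Φ` is the composition of the termwise extensions of `Φ` and `Ψ`. -/
noncomputable def bidualComplexIso (X : CochainComplex 𝒜 ℤ) :
    ((bidual Φ Ψ).mapHomologicalComplex (ComplexShape.up ℤ)).obj X ≅
      (onComplexes Ψ).obj (op ((onComplexes Φ).obj (op X))) :=
  HomologicalComplex.Hom.isoOfComponents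
    (fun i => (bidual Φ Ψ).mapIso (X.XIsoOfEq (neg_neg i).symm))
    (fun i j _ => by
      have h : X.d i j ≫ (X.XIsoOfEq (neg_neg j).symm).hom =
        (X.XIsoOfEq (neg_neg i).symm).hom ≫ X.d (- -i) (- -j) := by simp
      exact ((bidual Φ Ψ).map_comp _ _).symm.trans ((congrArg (bidual Φ Ψ).map h.symm).trans
        ((bidual Φ Ψ).map_comp _ _)))

lemma bidualComplexIso_hom_naturality {X Y : CochainComplex 𝒜 ℤ} (f : X ⟶ Y) :
    ((bidual Φ Ψ).mapHomologicalComplex (ComplexShape.up ℤ)).map f ≫ (bidualComplexIso Φ Ψ Y).hom =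
      (bidualComplexIso Φ Ψ X).hom ≫ (onComplexes Ψ).map ((onComplexes Φ).map f.op).op := by
  ext i
  have h : f.f i ≫ (Y.XIsoOfEq (neg_neg i).symm).hom =
      (X.XIsoOfEq (neg_neg i).symm).hom ≫ f.f (- -i) :=
    HomologicalComplex.XIsoOfEq_hom_naturality f (neg_neg i).symm
  exact ((bidual Φ Ψ).map_comp _ _).symm.trans ((congrArg (bidual Φ Ψ).map h).trans
    ((bidual Φ Ψ).map_comp _ _))

lemma termwise_comp_bidualComplexIso_hom (adj : Φ.rightOp ⊣ Ψ) (X : CochainComplex 𝒜 ℤ) :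
    (termwise adj.unit).app X ≫ (bidualComplexIso Φ Ψ X).hom = unitComplex adj X := by
  ext i
  exact (adj.unit.naturality (X.XIsoOfEq (neg_neg i).symm).hom).symm

/-- The termwise extension of `Ψ Φ` to the homotopy category. -/
noncomputable def bidualHomotopyIso (X : HomotopyCategory 𝒜 (ComplexShape.up ℤ)) :
    ((bidual Φ Ψ).mapHomotopyCategory (ComplexShape.up ℤ)).obj X ≅
      (onHomotopy Ψ).obj (op ((onHomotopy Φ).obj (op X))) :=
  (HomotopyCategory.quotient 𝒜 (ComplexShape.up ℤ)).mapIso (bidualComplexIso Φ Ψ X.as)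

lemma bidualHomotopyIso_hom_naturality {X Y : HomotopyCategory 𝒜 (ComplexShape.up ℤ)}
    (f : X ⟶ Y) :
    ((bidual Φ Ψ).mapHomotopyCategory (ComplexShape.up ℤ)).map f ≫ (bidualHomotopyIso Y).hom =
      (bidualHomotopyIso X).hom ≫ (onHomotopy Ψ).map ((onHomotopy Φ).map f.op).op := by
  obtain ⟨f : X.as ⟶ Y.as, rfl⟩ :=
    (HomotopyCategory.quotient 𝒜 (ComplexShape.up ℤ)).map_surjective f
  exact congrArg (HomotopyCategory.quotient 𝒜 (ComplexShape.up ℤ)).map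
    (bidualComplexIso_hom_naturality f)

lemma termwiseK_comp_bidualHomotopyIso_hom (adj : Φ.rightOp ⊣ Ψ) {s t : Bound}
    (hΦ : MapsBound Φ s t) (hΨ : MapsBound Ψ t s) (X : KCat 𝒜 s) :
    (termwiseK adj.unit).app X.obj ≫ (bidualHomotopyIso X.obj).hom = (unitK adj hΦ hΨ X).hom :=
  congrArg (HomotopyCategory.quotient 𝒜 (ComplexShape.up ℤ)).map
    (termwise_comp_bidualComplexIso_hom adj X.obj.as)

lemma qis_unitK_iff (adj : Φ.rightOp ⊣ Ψ) {s t : Bound}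
    (hΦ : MapsBound Φ s t) (hΨ : MapsBound Ψ t s) (X : KCat 𝒜 s) :
    qis 𝒜 s (unitK adj hΦ hΨ X) ↔
      HomotopyCategory.quasiIso 𝒜 (ComplexShape.up ℤ) ((termwiseK adj.unit).app X.obj) := by
  refine Iff.trans (iff_of_eq ?_)
    ((HomotopyCategory.quasiIso 𝒜 (ComplexShape.up ℤ)).cancel_right_of_respectsIso
      ((termwiseK adj.unit).app X.obj) (bidualHomotopyIso X.obj).hom)
  exact congrArg (fun k => HomotopyCategory.quasiIso 𝒜 (ComplexShape.up ℤ) k)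
    (termwiseK_comp_bidualHomotopyIso_hom adj hΦ hΨ X).symm

variable {s t : Bound} {S : ObjectProperty (HomotopyCategory 𝒜 (ComplexShape.up ℤ))}
  {U : ObjectProperty (HomotopyCategory ℬ (ComplexShape.up ℤ))}
  (hS : IsAdapted Φ s S) (hU : IsAdapted Ψ t U)
  (hSU : ∀ X, S X → U ((onHomotopy Φ).obj (op X)))

include hS hU hSU in
-- The hypothesis `hSU` allows `quasiIso_map` to be applied twice, for `Φ` and then for `Ψ`.
lemma quasiIso_bidual_map {X Y : HomotopyCategory 𝒜 (ComplexShape.up ℤ)} (f : X ⟶ Y)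
    (hX : S X) (hY : S Y) (hf : HomotopyCategory.quasiIso 𝒜 (ComplexShape.up ℤ) f) :
    HomotopyCategory.quasiIso 𝒜 (ComplexShape.up ℤ)
      (((bidual Φ Ψ).mapHomotopyCategory (ComplexShape.up ℤ)).map f) := by
  have h₁ := hS.quasiIso_map f (S.le_isoClosure _ hX) (S.le_isoClosure _ hY) hf
  have h₂ := hU.quasiIso_map _ (U.le_isoClosure _ (hSU _ hY)) (U.le_isoClosure _ (hSU _ hX)) h₁
  have h₃ := bidualHomotopyIso_hom_naturality (Φ := Φ) (Ψ := Ψ) f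
  rw [← (HomotopyCategory.quasiIso 𝒜 (ComplexShape.up ℤ)).cancel_right_of_respectsIso _
    (bidualHomotopyIso Y).hom, h₃]
  exact ((HomotopyCategory.quasiIso 𝒜 (ComplexShape.up ℤ)).cancel_left_of_respectsIso _ _).2 h₂

/-- The derived unit at the complex `X` is an isomorphism in degree `j`: this means that the cone of
the unit at a resolution of `X` in `S` has no cohomology in degree `j`. -/
def UnitIsoAt (adj : Φ.rightOp ⊣ Ψ) (S : ObjectProperty (HomotopyCategory 𝒜 (ComplexShape.up ℤ)))
    (j : ℤ) (X : KCat 𝒜 s) : Prop :=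
  ∃ (P : KCat 𝒜 s) (p : P ⟶ X), S P.obj ∧ qis 𝒜 s p ∧ IsoAt j ((termwiseK adj.unit).app P.obj)

variable (adj : Φ.rightOp ⊣ Ψ)

include hS hU hSU in
lemma isoAt_iff_of_quasiIso {X Y : HomotopyCategory 𝒜 (ComplexShape.up ℤ)} (f : X ⟶ Y)
    (hX : S X) (hY : S Y) (hf : HomotopyCategory.quasiIso 𝒜 (ComplexShape.up ℤ) f) (j : ℤ) :
    IsoAt j ((termwiseK adj.unit).app X) ↔ IsoAt j ((termwiseK adj.unit).app Y) := by
  rw [← isoAt_comp_iff _ _ (quasiIso_bidual_map hS hU hSU f hX hY hf), ← isoAt_precomp_iff f _ hf]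
  exact iff_of_eq (congrArg (IsoAt j) ((termwiseK adj.unit).naturality f).symm)

include hS hU hSU in
-- Independence of the resolution: two of them are dominated by a third, and `ΨΦ` preserves the
-- comparison quasi-isomorphisms.
lemma unitIsoAt_iff {P X : KCat 𝒜 s} (p : P ⟶ X) (hP : S P.obj) (hp : qis 𝒜 s p) (j : ℤ) :
    UnitIsoAt adj S j X ↔ IsoAt j ((termwiseK adj.unit).app P.obj) := by
  refine ⟨?_, fun h => ⟨P, p, hP, hp, h⟩⟩
  rintro ⟨P', p', hP', hp', h⟩
  obtain ⟨R, a, b, hR, ha, hab⟩ := hS.exists_resolution_of_spanK p' p hp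
  have hb : qis 𝒜 s b := by
    refine MorphismProperty.of_postcomp (HomotopyCategory.quasiIso 𝒜 (ComplexShape.up ℤ))
      b.hom p.hom hp ?_
    exact Eq.mp (congrArg (fun k => qis 𝒜 s k) hab) ((qis 𝒜 s).comp_mem _ _ ha hp')
  rw [← isoAt_iff_of_quasiIso hS hU hSU adj b.hom hR hP hb]
  exact (isoAt_iff_of_quasiIso hS hU hSU adj a.hom hR hP' ha j).2 h

include hS hU hSU in
lemma unitIsoAt_iff_of_qis {X Y : KCat 𝒜 s} (f : X ⟶ Y) (hf : qis 𝒜 s f) (j : ℤ) :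
    UnitIsoAt adj S j X ↔ UnitIsoAt adj S j Y := by
  obtain ⟨P, p, hP, hp⟩ := hS.exists_resolutionK X
  rw [unitIsoAt_iff hS hU hSU adj p hP hp,
    unitIsoAt_iff hS hU hSU adj (p ≫ f) hP ((qis 𝒜 s).comp_mem _ _ hp hf)]

variable (hΦ : MapsBound Φ s t) (hΨ : MapsBound Ψ t s)
  {RΦ : (DCat 𝒜 s)ᵒᵖ ⥤ DCat ℬ t} {RΨ : (DCat ℬ t)ᵒᵖ ⥤ DCat 𝒜 s}
  (α : onK Φ hΦ ⋙ locQ ℬ t ⟶ (locQ 𝒜 s).op ⋙ RΦ) (hRΦ : IsDerived Φ hΦ RΦ α)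
  (β : onK Ψ hΨ ⋙ locQ 𝒜 s ⟶ (locQ ℬ t).op ⋙ RΨ) (hRΨ : IsDerived Ψ hΨ RΨ β)
  (Radj : RΦ.rightOp ⊣ RΨ) (hRadj : IsInduced adj hΦ hΨ α β Radj)

include hS hU hSU hRΦ hRΨ hRadj in
-- At `P` both comparison maps in `IsInduced` are isomorphisms, the one for `Ψ` because `Φ P` is
-- again adapted. The derived unit at `P` is thus the termwise unit up to isomorphism.
lemma isIso_unit_app_iff {P X : KCat 𝒜 s} (p : P ⟶ X) (hP : S P.obj) (hp : qis 𝒜 s p) :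
    IsIso (Radj.unit.app ((locQ 𝒜 s).obj X)) ↔
      HomotopyCategory.quasiIso 𝒜 (ComplexShape.up ℤ) ((termwiseK adj.unit).app P.obj) := by
  rw [← qis_unitK_iff adj hΦ hΨ, ← isIso_locQ_map_iff]
  have hp' : IsIso ((locQ 𝒜 s).map p) := (isIso_locQ_map_iff s p).2 hp
  have hα : IsIso (α.app (op P)) := hS.isIso_of_isDerived hΦ RΦ α hRΦ P hP
  have hβ : IsIso (β.app (op ((onK Φ hΦ).obj (op P)))) :=
    hU.isIso_of_isDerived hΨ RΨ β hRΨ _ (hSU _ hP)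
  let e := asIso ((locQ 𝒜 s).map p)
  have h₁ : IsIso (Radj.unit.app ((locQ 𝒜 s).obj X)) ↔
      IsIso (Radj.unit.app ((locQ 𝒜 s).obj P)) :=
    ((MorphismProperty.isomorphisms _).arrow_mk_iso_iff
      (Arrow.isoMk e ((RΦ.rightOp ⋙ RΨ).mapIso e)
        (Radj.unit.naturality ((locQ 𝒜 s).map p)))).symm
  have hα' : IsIso (RΨ.map (α.app (op P)).op) := inferInstance
  have h₂ : IsIso (Radj.unit.app ((locQ 𝒜 s).obj P)) ↔
      IsIso (Radj.unit.app ((locQ 𝒜 s).obj P) ≫ RΨ.map (α.app (op P)).op) :=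
    ((MorphismProperty.isomorphisms _).cancel_right_of_respectsIso _ _).symm
  have h₃ : IsIso ((locQ 𝒜 s).map (unitK adj hΦ hΨ P)) ↔
      IsIso ((locQ 𝒜 s).map (unitK adj hΦ hΨ P) ≫ β.app (op ((onK Φ hΦ).obj (op P)))) :=
    ((MorphismProperty.isomorphisms _).cancel_right_of_respectsIso _ _).symm
  rw [h₁, h₂, h₃]
  exact iff_of_eq (congrArg (fun k => IsIso k) (hRadj P))

include hS hU hSU hRΦ hRΨ hRadj in
theorem reflexive_iff (A : 𝒜) :
    reflexive Radj A ↔ ∀ j : ℤ, UnitIsoAt adj S j (stalkK s A) := by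
  obtain ⟨P, p, hP, hp⟩ := hS.exists_resolutionK (stalkK s A)
  refine (isIso_unit_app_iff hS hU hSU adj hΦ hΨ α hRΦ β hRΨ Radj hRadj p hP hp).trans ?_
  rw [quasiIso_iff_isoAt]
  exact forall_congr' fun j => (unitIsoAt_iff hS hU hSU adj p hP hp j).symm

end Contravariant

end DReflexive

namespace DReflexive

open Pretriangulated

/-! ### The derived unit along triangles and short exact sequences -/

section Triangles

variable {𝒜 : Type u₁} [Category.{v₁} 𝒜] [Abelian 𝒜] {ℬ : Type u₂} [Category.{v₂} ℬ] [Abelian ℬ]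

lemma IsAdapted.exists_resolution_triangle {F : 𝒜ᵒᵖ ⥤ ℬ} [F.Additive] {s : Bound}
    {S : ObjectProperty (HomotopyCategory 𝒜 (ComplexShape.up ℤ))} (hS : IsAdapted F s S)
    {T : Triangle (HomotopyCategory 𝒜 (ComplexShape.up ℤ))} (hT : T ∈ distTriang _)
    (h₁ : s.objects 𝒜 T.obj₁) (h₂ : s.objects 𝒜 T.obj₂) :
    ∃ (T' : Triangle (HomotopyCategory 𝒜 (ComplexShape.up ℤ))) (_ : T' ∈ distTriang _)
      (φ : T' ⟶ T), (S T'.obj₁ ∧ S T'.obj₂ ∧ S T'.obj₃) ∧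
      HomotopyCategory.quasiIso 𝒜 (ComplexShape.up ℤ) φ.hom₁ ∧
      HomotopyCategory.quasiIso 𝒜 (ComplexShape.up ℤ) φ.hom₂ ∧
      HomotopyCategory.quasiIso 𝒜 (ComplexShape.up ℤ) φ.hom₃ := by
  have := hS.isTriangulated
  let X₁ : KCat 𝒜 s := ⟨T.obj₁, h₁⟩
  let X₂ : KCat 𝒜 s := ⟨T.obj₂, h₂⟩
  let f : X₁ ⟶ X₂ := ObjectProperty.homMk T.mor₁
  -- The target is resolved before the source, so that the resolution of the source can be chosen to
  -- make the square commute strictly.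
  obtain ⟨P₂, p₂, hP₂, hp₂⟩ := hS.exists_resolutionK X₂
  obtain ⟨P₁, p₁, g, hP₁, hp₁, hg⟩ := hS.exists_resolution_of_spanK f p₂ hp₂
  obtain ⟨P₃, hP₃, a, b, hT'⟩ := S.distinguished_cocone_triangle g.hom hP₁ hP₂
  have comm : g.hom ≫ p₂.hom = p₁.hom ≫ T.mor₁ := congrArg (fun k => k.hom) hg.symm
  obtain ⟨c, hc₁, hc₂⟩ := complete_distinguished_triangle_morphism _ _ hT' hT p₁.hom p₂.hom comm
  let φ : Triangle.mk g.hom a b ⟶ T :=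
    { hom₁ := p₁.hom, hom₂ := p₂.hom, hom₃ := c, comm₁ := comm, comm₂ := hc₁, comm₃ := hc₂ }
  exact ⟨_, hT', φ, ⟨hP₁, hP₂, hP₃⟩, hp₁, hp₂, quasiIso_hom₃ hT' hT φ hp₁ hp₂⟩

variable {Φ : 𝒜ᵒᵖ ⥤ ℬ} {Ψ : ℬᵒᵖ ⥤ 𝒜} [Φ.Additive] [Ψ.Additive]
  {s t : Bound} {S : ObjectProperty (HomotopyCategory 𝒜 (ComplexShape.up ℤ))}
  {U : ObjectProperty (HomotopyCategory ℬ (ComplexShape.up ℤ))}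
  (hS : IsAdapted Φ s S) (hU : IsAdapted Ψ t U)
  (hSU : ∀ X, S X → U ((onHomotopy Φ).obj (op X))) (adj : Φ.rightOp ⊣ Ψ)

include hS hU hSU

lemma unitIsoAt_obj₃_iff {T : Triangle (HomotopyCategory 𝒜 (ComplexShape.up ℤ))}
    (hT : T ∈ distTriang _) (h₁ : s.objects 𝒜 T.obj₁) (h₂ : s.objects 𝒜 T.obj₂)
    (h₃ : s.objects 𝒜 T.obj₃) (h : ∀ j : ℤ, UnitIsoAt adj S j (⟨T.obj₂, h₂⟩ : KCat 𝒜 s)) (j : ℤ) :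
    UnitIsoAt adj S j (⟨T.obj₃, h₃⟩ : KCat 𝒜 s) ↔
      UnitIsoAt adj S (j + 1) (⟨T.obj₁, h₁⟩ : KCat 𝒜 s) := by
  obtain ⟨T', hT', φ, ⟨hP₁, hP₂, hP₃⟩, hφ₁, hφ₂, hφ₃⟩ := hS.exists_resolution_triangle hT h₁ h₂
  have H₁ := unitIsoAt_iff hS hU hSU adj (P := ⟨T'.obj₁, hS.le_objects _ hP₁⟩)
    (X := ⟨T.obj₁, h₁⟩) (ObjectProperty.homMk φ.hom₁) hP₁ hφ₁
  have H₂ := unitIsoAt_iff hS hU hSU adj (P := ⟨T'.obj₂, hS.le_objects _ hP₂⟩)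
    (X := ⟨T.obj₂, h₂⟩) (ObjectProperty.homMk φ.hom₂) hP₂ hφ₂
  have H₃ := unitIsoAt_iff hS hU hSU adj (P := ⟨T'.obj₃, hS.le_objects _ hP₃⟩)
    (X := ⟨T.obj₃, h₃⟩) (ObjectProperty.homMk φ.hom₃) hP₃ hφ₃
  rw [H₁, H₃]
  exact isoAt_hom₃_iff hT' (Functor.map_distinguished _ _ hT') (termwiseTriangle adj.unit T')
    ((quasiIso_iff_isoAt _).2 fun i => (H₂ i).1 (h i)) j

lemma unitIsoAt_obj₂ {T : Triangle (HomotopyCategory 𝒜 (ComplexShape.up ℤ))}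
    (hT : T ∈ distTriang _) (h₁ : s.objects 𝒜 T.obj₁) (h₂ : s.objects 𝒜 T.obj₂)
    (h₃ : s.objects 𝒜 T.obj₃) (h : ∀ j : ℤ, UnitIsoAt adj S j (⟨T.obj₁, h₁⟩ : KCat 𝒜 s))
    (h' : ∀ j : ℤ, UnitIsoAt adj S j (⟨T.obj₃, h₃⟩ : KCat 𝒜 s)) (j : ℤ) :
    UnitIsoAt adj S j (⟨T.obj₂, h₂⟩ : KCat 𝒜 s) := by
  obtain ⟨T', hT', φ, ⟨hP₁, hP₂, hP₃⟩, hφ₁, hφ₂, hφ₃⟩ := hS.exists_resolution_triangle hT h₁ h₂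
  have H₁ := unitIsoAt_iff hS hU hSU adj (P := ⟨T'.obj₁, hS.le_objects _ hP₁⟩)
    (X := ⟨T.obj₁, h₁⟩) (ObjectProperty.homMk φ.hom₁) hP₁ hφ₁
  have H₂ := unitIsoAt_iff hS hU hSU adj (P := ⟨T'.obj₂, hS.le_objects _ hP₂⟩)
    (X := ⟨T.obj₂, h₂⟩) (ObjectProperty.homMk φ.hom₂) hP₂ hφ₂
  have H₃ := unitIsoAt_iff hS hU hSU adj (P := ⟨T'.obj₃, hS.le_objects _ hP₃⟩)
    (X := ⟨T.obj₃, h₃⟩) (ObjectProperty.homMk φ.hom₃) hP₃ hφ₃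
  rw [H₂]
  exact (quasiIso_iff_isoAt _).1 (quasiIso_hom₂ hT' (Functor.map_distinguished _ _ hT')
    (termwiseTriangle adj.unit T') ((quasiIso_iff_isoAt _).2 fun i => (H₁ i).1 (h i))
    ((quasiIso_iff_isoAt _).2 fun i => (H₃ i).1 (h' i))) j

end Triangles

section ShortExactSequences

variable {𝒜 : Type u₁} [Category.{v₁} 𝒜] [Abelian 𝒜] {ℬ : Type u₂} [Category.{v₂} ℬ] [Abelian ℬ]

/-- The cone of the monomorphism in a short exact sequence, as an object of `K^s(𝒜)`. -/
noncomputable def coneK (s : Bound) {A B : 𝒜} (f : A ⟶ B) : KCat 𝒜 s :=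
  ⟨(HomotopyCategory.quotient 𝒜 (ComplexShape.up ℤ)).obj (CochainComplex.mappingCone
    ((HomologicalComplex.single 𝒜 (ComplexShape.up ℤ) 0).map f)),
    s.complexes_mappingCone _ (stalkComplex_mem s A) (stalkComplex_mem s B)⟩

lemma exists_qis_coneK (s : Bound) {E : ShortComplex 𝒜} (hE : E.ShortExact) :
    ∃ f : coneK s E.f ⟶ stalkK s E.X₃, qis 𝒜 s f :=
  ⟨ObjectProperty.homMk ((HomotopyCategory.quotient 𝒜 (ComplexShape.up ℤ)).map
      (CochainComplex.mappingCone.descShortComplex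
        (E.map (HomologicalComplex.single 𝒜 (ComplexShape.up ℤ) 0)))),
    (HomotopyCategory.quotient_map_mem_quasiIso_iff _).2
      (CochainComplex.mappingCone.quasiIso_descShortComplex
        (hE.map_of_exact (HomologicalComplex.single 𝒜 (ComplexShape.up ℤ) 0)))⟩

variable {Φ : 𝒜ᵒᵖ ⥤ ℬ} {Ψ : ℬᵒᵖ ⥤ 𝒜} [Φ.Additive] [Ψ.Additive]
  {s t : Bound} {S : ObjectProperty (HomotopyCategory 𝒜 (ComplexShape.up ℤ))}
  {U : ObjectProperty (HomotopyCategory ℬ (ComplexShape.up ℤ))}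
  (hS : IsAdapted Φ s S) (hU : IsAdapted Ψ t U)
  (hSU : ∀ X, S X → U ((onHomotopy Φ).obj (op X))) (adj : Φ.rightOp ⊣ Ψ)
  {E : ShortComplex 𝒜} (hE : E.ShortExact)

include hS hU hSU hE

/-- A short exact sequence of stalks need not be a triangle in the homotopy category. The quotient
is replaced by the quasi-isomorphic mapping cone of `E.f`. -/
theorem unitIsoAt_X₃_iff (h : ∀ j : ℤ, UnitIsoAt adj S j (stalkK s E.X₂)) (j : ℤ) :
    UnitIsoAt adj S j (stalkK s E.X₃) ↔ UnitIsoAt adj S (j + 1) (stalkK s E.X₁) := by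
  obtain ⟨f, hf⟩ := exists_qis_coneK s hE
  rw [← unitIsoAt_iff_of_qis hS hU hSU adj f hf]
  exact unitIsoAt_obj₃_iff hS hU hSU adj
    (HomotopyCategory.mappingCone_triangleh_distinguished
      ((HomologicalComplex.single 𝒜 (ComplexShape.up ℤ) 0).map E.f))
    (stalkK s E.X₁).property (stalkK s E.X₂).property (coneK s E.f).property h j

theorem unitIsoAt_X₂ (h : ∀ j : ℤ, UnitIsoAt adj S j (stalkK s E.X₁))
    (h' : ∀ j : ℤ, UnitIsoAt adj S j (stalkK s E.X₃)) (j : ℤ) :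
    UnitIsoAt adj S j (stalkK s E.X₂) := by
  obtain ⟨f, hf⟩ := exists_qis_coneK s hE
  exact unitIsoAt_obj₂ hS hU hSU adj
    (HomotopyCategory.mappingCone_triangleh_distinguished
      ((HomologicalComplex.single 𝒜 (ComplexShape.up ℤ) 0).map E.f))
    (stalkK s E.X₁).property (stalkK s E.X₂).property (coneK s E.f).property h
    (fun i => (unitIsoAt_iff_of_qis hS hU hSU adj f hf i).2 (h' i)) j

end ShortExactSequences

end DReflexive

namespace DReflexive

/-! ### Canonical truncations within a boundedness condition -/

section Truncation

variable {C : Type u} [Category.{v} C] [Abelian C]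

lemma isLE_of_isZero_homologyFunctor {X : HomotopyCategory C (ComplexShape.up ℤ)} {n : ℤ}
    (h : ∀ i, n < i →
      IsZero ((HomotopyCategory.homologyFunctor C (ComplexShape.up ℤ) i).obj X)) :
    CochainComplex.IsLE X.as n :=
  (CochainComplex.isLE_iff _ _).2 fun i hi =>
    (HomologicalComplex.exactAt_iff_isZero_homology _ _).2
      ((h i hi).of_iso ((HomotopyCategory.homologyFunctorFactors C (ComplexShape.up ℤ) i).app
        X.as).symm)

lemma isZero_homologyFunctor_of_isZero_X {L : CochainComplex C ℤ} {i : ℤ} (h : IsZero (L.X i)) :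
    IsZero ((HomotopyCategory.homologyFunctor C (ComplexShape.up ℤ) i).obj
      ((HomotopyCategory.quotient C (ComplexShape.up ℤ)).obj L)) :=
  ((HomologicalComplex.exactAt_iff_isZero_homology _ _).1 (ShortComplex.exact_of_isZero_X₂ _ h)).of_iso
    ((HomotopyCategory.homologyFunctorFactors C (ComplexShape.up ℤ) i).app L)

/-- The terms of the truncation are subobjects, so truncation respects every boundedness condition.
-/
lemma isZero_truncLE_X_of_isZero (K : CochainComplex C ℤ) (n : ℤ) {i : ℤ} (h : IsZero (K.X i)) :
    IsZero ((K.truncLE n).X i) := by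
  have : Mono ((K.ιTruncLE n).f i) := by
    unfold CochainComplex.ιTruncLE
    infer_instance
  exact h.of_mono ((K.ιTruncLE n).f i)

/-- The canonical truncation of an object of `K^s(C)`. -/
noncomputable def truncK {s : Bound} (X : KCat C s) (n : ℤ) : KCat C s :=
  ⟨(HomotopyCategory.quotient C (ComplexShape.up ℤ)).obj (CochainComplex.truncLE X.obj.as n),
    s.complexes_of_isZero X.property fun _ =>
      isZero_truncLE_X_of_isZero X.obj.as n⟩

/-- The canonical morphism from the truncation. -/
noncomputable def ιTruncK {s : Bound} (X : KCat C s) (n : ℤ) : truncK X n ⟶ X :=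
  ObjectProperty.homMk
    ((HomotopyCategory.quotient C (ComplexShape.up ℤ)).map (CochainComplex.ιTruncLE X.obj.as n))

lemma qis_ιTruncK {s : Bound} (X : KCat C s) (n : ℤ)
    (h : ∀ i, n < i →
      IsZero ((HomotopyCategory.homologyFunctor C (ComplexShape.up ℤ) i).obj X.obj)) :
    qis C s (ιTruncK X n) := by
  have := isLE_of_isZero_homologyFunctor h
  exact (HomotopyCategory.quotient_map_mem_quasiIso_iff _).2
    (inferInstanceAs (QuasiIso (CochainComplex.ιTruncLE X.obj.as n)))

lemma isZero_truncLE_X (K : CochainComplex C ℤ) {n i : ℤ} (hi : n < i) :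
    IsZero ((K.truncLE n).X i) :=
  CochainComplex.isZero_of_isStrictlyLE _ n i hi

end Truncation

/-! ### Degrees in which the cone of the unit vanishes -/

section Bounds

variable {𝒜 : Type u₁} [Category.{v₁} 𝒜] [Abelian 𝒜] {ℬ : Type u₂} [Category.{v₂} ℬ] [Abelian ℬ]

/-- The truncation `τ` of `X` need not be adapted, so let `P` resolve it. The composite `P → τ → X`
is a quasi-isomorphism between adapted complexes, hence `F` turns it into an isomorphism on `H^i`.
That isomorphism factors through `H^i(F τ) = 0`, since the term of `τ` in degree `-i > n` vanishes.
-/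
lemma IsAdapted.isZero_homology_of_lt {F : 𝒜ᵒᵖ ⥤ ℬ} [F.Additive] {s : Bound}
    {S : ObjectProperty (HomotopyCategory 𝒜 (ComplexShape.up ℤ))} (hS : IsAdapted F s S)
    {X : HomotopyCategory 𝒜 (ComplexShape.up ℤ)} (hX : S X) {n : ℤ}
    (h : ∀ i, n < i → IsZero ((HomotopyCategory.homologyFunctor 𝒜 (ComplexShape.up ℤ) i).obj X))
    {i : ℤ} (hi : i < -n) :
    IsZero ((HomotopyCategory.homologyFunctor ℬ (ComplexShape.up ℤ) i).obj
      ((onHomotopy F).obj (op X))) := by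
  let Y : KCat 𝒜 s := ⟨X, hS.le_objects _ hX⟩
  obtain ⟨P, p, hP, hp⟩ := hS.exists_resolutionK (truncK Y n)
  have hq := hS.quasiIso_map (p ≫ ιTruncK Y n).hom (S.le_isoClosure _ hP) (S.le_isoClosure _ hX)
    ((qis 𝒜 s).comp_mem _ _ hp (qis_ιTruncK Y n h)) i
  have hz : IsZero ((HomotopyCategory.homologyFunctor ℬ (ComplexShape.up ℤ) i).obj
      ((onHomotopy F).obj (op (truncK Y n).obj))) :=
    isZero_homologyFunctor_of_isZero_X (L := (onComplexes F).obj (op (CochainComplex.truncLE X.as n)))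
      (F.map_isZero (isZero_truncLE_X X.as (by lia : n < -i)).op)
  let H := HomotopyCategory.homologyFunctor ℬ (ComplexShape.up ℤ) i
  have hfac : H.map ((onHomotopy F).map (p ≫ ιTruncK Y n).hom.op) =
      H.map ((onHomotopy F).map (ιTruncK Y n).hom.op) ≫ H.map ((onHomotopy F).map p.hom.op) :=
    (congrArg H.map ((onHomotopy F).map_comp (ιTruncK Y n).hom.op p.hom.op)).trans
      (H.map_comp _ _)
  rw [IsZero.iff_id_eq_zero]
  have h0 : H.map ((onHomotopy F).map (p ≫ ιTruncK Y n).hom.op) = 0 :=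
    hfac.trans ((congrArg (fun k => k ≫ _) (hz.eq_of_tgt _ 0)).trans zero_comp)
  exact (cancel_mono (H.map ((onHomotopy F).map (p ≫ ιTruncK Y n).hom.op))).1
    ((congrArg (fun k => _ ≫ k) h0).trans (comp_zero.trans zero_comp.symm))

variable {Φ : 𝒜ᵒᵖ ⥤ ℬ} {Ψ : ℬᵒᵖ ⥤ 𝒜} [Φ.Additive] [Ψ.Additive]
  {s t : Bound} {S : ObjectProperty (HomotopyCategory 𝒜 (ComplexShape.up ℤ))}
  {U : ObjectProperty (HomotopyCategory ℬ (ComplexShape.up ℤ))}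
  (hS : IsAdapted Φ s S) (hU : IsAdapted Ψ t U)
  (hSU : ∀ X, S X → U ((onHomotopy Φ).obj (op X)))

include hS hU hSU

/-- Same factorization through the truncation, now for the covariant `ΨΦ`, which preserves degrees.
-/
lemma isZero_homology_bidual_of_gt {X : HomotopyCategory 𝒜 (ComplexShape.up ℤ)} (hX : S X) {n : ℤ}
    (h : ∀ i, n < i → IsZero ((HomotopyCategory.homologyFunctor 𝒜 (ComplexShape.up ℤ) i).obj X))
    {i : ℤ} (hi : n < i) :
    IsZero ((HomotopyCategory.homologyFunctor 𝒜 (ComplexShape.up ℤ) i).obj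
      (((bidual Φ Ψ).mapHomotopyCategory (ComplexShape.up ℤ)).obj X)) := by
  let Y : KCat 𝒜 s := ⟨X, hS.le_objects _ hX⟩
  obtain ⟨P, p, hP, hp⟩ := hS.exists_resolutionK (truncK Y n)
  have hq := quasiIso_bidual_map hS hU hSU (p ≫ ιTruncK Y n).hom hP hX
    ((qis 𝒜 s).comp_mem _ _ hp (qis_ιTruncK Y n h)) i
  let T := (bidual Φ Ψ).mapHomotopyCategory (ComplexShape.up ℤ)
  let H := HomotopyCategory.homologyFunctor 𝒜 (ComplexShape.up ℤ) i
  have hz : IsZero (H.obj (T.obj (truncK Y n).obj)) :=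
    isZero_homologyFunctor_of_isZero_X
      (L := ((bidual Φ Ψ).mapHomologicalComplex (ComplexShape.up ℤ)).obj (CochainComplex.truncLE X.as n))
      ((bidual Φ Ψ).map_isZero (isZero_truncLE_X X.as hi))
  have hfac : H.map (T.map (p ≫ ιTruncK Y n).hom) =
      H.map (T.map p.hom) ≫ H.map (T.map (ιTruncK Y n).hom) :=
    (congrArg H.map (T.map_comp p.hom (ιTruncK Y n).hom)).trans (H.map_comp _ _)
  have h0 : H.map (T.map (p ≫ ιTruncK Y n).hom) = 0 :=
    hfac.trans ((congrArg (fun k => k ≫ _) (hz.eq_of_tgt _ 0)).trans zero_comp)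
  rw [IsZero.iff_id_eq_zero]
  exact (cancel_epi (H.map (T.map (p ≫ ιTruncK Y n).hom))).1
    ((congrArg (fun k => k ≫ _) h0).trans (zero_comp.trans comp_zero.symm))

variable (hΦ : MapsBound Φ s t)
  {RΦ : (DCat 𝒜 s)ᵒᵖ ⥤ DCat ℬ t} (α : onK Φ hΦ ⋙ locQ ℬ t ⟶ (locQ 𝒜 s).op ⋙ RΦ)
  (hRΦ : IsDerived Φ hΦ RΦ α)

omit hU hSU in
include hRΦ in
/-- The derived functor is computed by resolutions in an adapted subcategory. -/
lemma nonempty_derivedCohomology_iso {A : 𝒜} {P : KCat 𝒜 s} (p : P ⟶ stalkK s A) (hP : S P.obj)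
    (hp : qis 𝒜 s p) (i : ℤ) :
    Nonempty (derivedCohomology RΦ i A ≅
      (HomotopyCategory.homologyFunctor ℬ (ComplexShape.up ℤ) i).obj
        ((onHomotopy Φ).obj (op P.obj))) := by
  have : IsIso (α.app (op P)) := hS.isIso_of_isDerived hΦ RΦ α hRΦ P hP
  have : IsIso ((locQ 𝒜 s).map p) := (isIso_locQ_map_iff s p).2 hp
  let e := asIso ((locQ 𝒜 s).map p)
  exact ⟨(cohomology ℬ t i).mapIso (RΦ.mapIso e.op ≪≫ (asIso (α.app (op P))).symm) ≪≫
    cohomologyIso t i ((onK Φ hΦ).obj (op P))⟩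

omit hS hU hSU in
lemma isZero_homologyFunctor_of_qis_stalkK {A : 𝒜} {P : KCat 𝒜 s} (p : P ⟶ stalkK s A)
    (hp : qis 𝒜 s p) {i : ℤ} (hi : i ≠ 0) :
    IsZero ((HomotopyCategory.homologyFunctor 𝒜 (ComplexShape.up ℤ) i).obj P.obj) := by
  have : IsIso ((HomotopyCategory.homologyFunctor 𝒜 (ComplexShape.up ℤ) i).map p.hom) := hp i
  exact (HomologicalComplex.isZero_single_obj_homology (ComplexShape.up ℤ) 0 A i hi).of_iso
    (asIso ((HomotopyCategory.homologyFunctor 𝒜 (ComplexShape.up ℤ) i).map p.hom) ≪≫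
      (HomotopyCategory.homologyFunctorFactors 𝒜 (ComplexShape.up ℤ) i).app (stalkComplex A))

variable (adj : Φ.rightOp ⊣ Ψ) (A : 𝒜) {j : ℤ}

theorem unitIsoAt_of_pos (hj : 0 < j) : UnitIsoAt adj S j (stalkK s A) := by
  obtain ⟨P, p, hP, hp⟩ := hS.exists_resolutionK (stalkK s A)
  have hz {i : ℤ} (hi : i ≠ 0) := isZero_homologyFunctor_of_qis_stalkK p hp hi
  refine ⟨P, p, hP, hp, ?_, ?_⟩
  · have := isZero_homology_bidual_of_gt hS hU hSU hP (fun i hi => hz hi.ne') hj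
    exact ⟨fun _ _ _ => this.eq_of_src _ _⟩
  · exact ⟨fun _ _ _ => (hz (by lia)).eq_of_tgt _ _⟩

include hRΦ in
theorem unitIsoAt_of_lt {n : ℕ} (hn : CohomDimLE RΦ n) (hn₀ : n ≠ 0) (hj : j < -n) :
    UnitIsoAt adj S j (stalkK s A) := by
  obtain ⟨P, p, hP, hp⟩ := hS.exists_resolutionK (stalkK s A)
  refine ⟨P, p, hP, hp, ?_, ?_⟩
  · have hz (i : ℤ) (hi : n < i) := (hn A i (hi.trans_le (le_abs_self i))).of_iso
      (nonempty_derivedCohomology_iso hS hΦ α hRΦ p hP hp i).some.symm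
    have := (hU.isZero_homology_of_lt (hSU _ hP) hz hj).of_iso
      ((HomotopyCategory.homologyFunctor 𝒜 (ComplexShape.up ℤ) j).mapIso
        (bidualHomotopyIso P.obj))
    exact ⟨fun _ _ _ => this.eq_of_src _ _⟩
  -- Injectivity in degree `j + 1 ≤ -n` holds because the source vanishes there; `n ≠ 0` keeps this
  -- degree away from `0`.
  · exact ⟨fun _ _ _ => (isZero_homologyFunctor_of_qis_stalkK p hp (by lia)).eq_of_tgt _ _⟩

end Bounds

end DReflexive

namespace DReflexive

/-! ### Exact abelian subcategories -/

section AbelianSubcategories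

variable {C : Type u} [Category.{v} C] [Abelian C]

lemma shortExact_kernel_coimage {X Y : C} (f : X ⟶ Y) :
    (ShortComplex.mk (kernel.ι f) (Abelian.coimage.π f) (cokernel.condition _)).ShortExact :=
  .mk' (ShortComplex.exact_cokernel (kernel.ι f)) inferInstance inferInstance

lemma shortExact_image_cokernel {X Y : C} (f : X ⟶ Y) :
    (ShortComplex.mk (Abelian.image.ι f) (cokernel.π f) (kernel.condition _)).ShortExact :=
  .mk' (ShortComplex.exact_kernel (cokernel.π f)) inferInstance inferInstance

/-- In an exact sequence, the image of a morphism is the kernel of the next one. -/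
noncomputable def imageIsoKernelOfExact {E : ShortComplex C} (hE : E.Exact) :
    Abelian.image E.f ≅ kernel E.g :=
  let e : Abelian.image E.f ≅ kernel (kernel.ι E.g ≫ cokernel.π E.f) :=
    IsLimit.conePointUniqueUpToIso E.abelianImageToKernelIsKernel (limit.isLimit _)
  e ≪≫ kernelIsoOfEq (E.exact_iff_kernel_ι_comp_cokernel_π_zero.1 hE) ≪≫ kernelZeroIsoSource

lemma isExactAbelianSubcategory_of_kernels_cokernels (P : ObjectProperty C)
    [P.IsClosedUnderIsomorphisms] (h₀ : ∀ X, IsZero X → P X)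
    (hker : ∀ ⦃X Y : C⦄ (f : X ⟶ Y), P X → P Y → P (kernel f))
    (hcoker : ∀ ⦃X Y : C⦄ (f : X ⟶ Y), P X → P Y → P (cokernel f))
    (hbiprod : ∀ ⦃X Y : C⦄, P X → P Y → P (X ⊞ Y)) : IsExactAbelianSubcategory P := by
  have : P.ContainsZero := ⟨_, isZero_zero C, h₀ _ (isZero_zero C)⟩
  have : P.IsClosedUnderKernels := ⟨by
    rintro _ ⟨f, k, hk, hf⟩
    exact P.prop_of_iso (IsLimit.conePointUniqueUpToIso (limit.isLimit _) hk)
      (hker f hf.1 hf.2)⟩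
  have : P.IsClosedUnderCokernels := ⟨by
    rintro _ ⟨f, k, hk, hf⟩
    exact P.prop_of_iso (IsColimit.coconePointUniqueUpToIso (colimit.isColimit _) hk)
      (hcoker f hf.1 hf.2)⟩
  have : P.IsClosedUnderBinaryProducts := ⟨by
    rintro X ⟨p⟩
    exact P.prop_of_iso (biprod.isoProd _ _ ≪≫ (HasLimit.isoOfNatIso (diagramIsoPair p.diag)).symm ≪≫
      IsLimit.conePointUniqueUpToIso (limit.isLimit _) p.isLimit)
      (hbiprod (p.prop_diag_obj _) (p.prop_diag_obj _))⟩
  have : P.IsClosedUnderFiniteProducts := .mk'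
  refine ⟨inferInstance, ?_, ?_⟩
  · have := P.preservesKernels_ι
    exact P.ι.preservesFiniteLimits_of_preservesKernels
  · have := P.preservesCokernels_ι
    exact P.ι.preservesFiniteColimits_of_preservesCokernels

end AbelianSubcategories

/-! ### Dimension shifting along an exact sequence -/

section ExactSequences

variable {C : Type u} [Category.{v} C] [Abelian C] {D : ℤ → C → Prop} {n : ℕ}
  (hiso : ∀ ⦃X Y : C⦄ (_ : X ≅ Y) (j : ℤ), D j X → D j Y)
  (hses : ∀ ⦃E : ShortComplex C⦄ (_ : E.ShortExact), (∀ j, D j E.X₂) →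
    ∀ j, D j E.X₃ ↔ D (j + 1) E.X₁)
  (hpos : ∀ (X : C) (j : ℤ), 0 < j → D j X)
  (hneg : n ≠ 0 → ∀ (X : C) (j : ℤ), j < -n → D j X)
  {M : ComposableArrows C n} (hM : M.Exact) (hD : ∀ (i : Fin (n + 1)) (j : ℤ), D j (M.obj i))

include hiso hses

lemma image_iff_kernel {X Y : C} (f : X ⟶ Y) (hX : ∀ j, D j X) (j : ℤ) :
    D j (Abelian.image f) ↔ D (j + 1) (kernel f) :=
  ⟨fun h => (hses (shortExact_kernel_coimage f) hX j).1
      (hiso (Abelian.coimageIsoImage f).symm j h),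
    fun h => hiso (Abelian.coimageIsoImage f) j
      ((hses (shortExact_kernel_coimage f) hX j).2 h)⟩

omit hiso in
lemma cokernel_iff_image {X Y : C} (f : X ⟶ Y) (hY : ∀ j, D j Y) (j : ℤ) :
    D j (cokernel f) ↔ D (j + 1) (Abelian.image f) :=
  hses (shortExact_image_cokernel f) hY j

include hM hD

include hpos in
-- Each step to the left raises the degree by one, until `hpos` applies to the kernel of the first
-- map.
lemma image_of_neg_le (i : ℕ) (hi : i < n) (j : ℤ) (hj : -i ≤ j) :
    D j (Abelian.image (M.map' i (i + 1) (Nat.le_succ i) hi)) := by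
  rw [image_iff_kernel hiso hses _ (hD _)]
  induction i generalizing j with
  | zero => exact hpos _ _ (by lia)
  | succ i ih =>
    refine hiso (imageIsoKernelOfExact (hM.exact i)) _ ?_
    exact (image_iff_kernel hiso hses _ (hD _) _).2 (ih (by lia) _ (by lia))

include hneg in
-- Each step to the right lowers the degree by one, until `hneg` applies to the cokernel of the last
-- map; `k` counts the maps after the `i`-th.
lemma image_of_lt_neg (k i : ℕ) (hk : i + k + 1 = n) (j : ℤ) (hj : j < -i) :
    D j (Abelian.image (M.map' i (i + 1) (Nat.le_succ i) (by lia))) := by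
  induction k generalizing i j with
  | zero =>
    have h := (cokernel_iff_image hses (M.map' i (i + 1) (Nat.le_succ i) (by lia))
      (hD _) (j - 1)).1
      (hneg (by lia) _ _ (by lia))
    rwa [sub_add_cancel] at h
  | succ k ih =>
    refine hiso (imageIsoKernelOfExact (hM.exact i)).symm _ ?_
    have h := (image_iff_kernel hiso hses (M.map' (i + 1) (i + 1 + 1) (Nat.le_succ _)
      (by lia)) (hD _) (j - 1)).1
      (ih (i + 1) (by lia) _ (by lia))
    rwa [sub_add_cancel] at h

include hpos hneg in
theorem kernel_and_cokernel_of_exact (i : ℕ) (hi : i < n) :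
    (∀ j, D j (kernel (M.map' i (i + 1) (Nat.le_succ i) hi))) ∧
      ∀ j, D j (cokernel (M.map' i (i + 1) (Nat.le_succ i) hi)) := by
  have h (j : ℤ) : D j (Abelian.image (M.map' i (i + 1) (Nat.le_succ i) hi)) := by
    obtain hj | hj := le_or_gt (-(i : ℤ)) j
    · exact image_of_neg_le hiso hses hpos hM hD i hi j hj
    · exact image_of_lt_neg hiso hses hneg hM hD (n - i - 1) i (by lia) j hj
  refine ⟨fun j => ?_, fun j => (cokernel_iff_image hses _ (hD _) j).2 (h _)⟩
  have h' := (image_iff_kernel hiso hses (M.map' i (i + 1) (Nat.le_succ i) hi)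
    (hD _) (j - 1)).1 (h _)
  rwa [sub_add_cancel] at h'

end ExactSequences

/-! ### Isomorphic and zero stalks -/

section Stalks

variable {𝒜 : Type u₁} [Category.{v₁} 𝒜] [Abelian 𝒜] {ℬ : Type u₂} [Category.{v₂} ℬ] [Abelian ℬ]
  {Φ : 𝒜ᵒᵖ ⥤ ℬ} {Ψ : ℬᵒᵖ ⥤ 𝒜} [Φ.Additive] [Ψ.Additive]
  {s t : Bound} {S : ObjectProperty (HomotopyCategory 𝒜 (ComplexShape.up ℤ))}
  {U : ObjectProperty (HomotopyCategory ℬ (ComplexShape.up ℤ))}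

lemma unitIsoAt_of_iso (hS : IsAdapted Φ s S) (hU : IsAdapted Ψ t U)
    (hSU : ∀ X, S X → U ((onHomotopy Φ).obj (op X))) (adj : Φ.rightOp ⊣ Ψ) {A B : 𝒜} (e : A ≅ B)
    (j : ℤ) (h : UnitIsoAt adj S j (stalkK s A)) : UnitIsoAt adj S j (stalkK s B) := by
  let e' := (HomotopyCategory.quotient 𝒜 (ComplexShape.up ℤ)).mapIso
    ((HomologicalComplex.single 𝒜 (ComplexShape.up ℤ) 0).mapIso e)
  let f : stalkK s A ⟶ stalkK s B := ObjectProperty.homMk e'.hom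
  exact (unitIsoAt_iff_of_qis hS hU hSU adj f
    (fun i => inferInstanceAs (IsIso ((HomotopyCategory.homologyFunctor 𝒜 _ i).map e'.hom))) j).1 h

lemma unitIsoAt_of_isZero (hS : IsAdapted Φ s S) (adj : Φ.rightOp ⊣ Ψ) {A : 𝒜} (hA : IsZero A)
    (j : ℤ) : UnitIsoAt adj S j (stalkK s A) := by
  have := hS.isTriangulated
  obtain ⟨Z, hZ, hSZ⟩ := S.exists_prop_of_containsZero
  have hA' : IsZero (stalkK s A).obj := (HomotopyCategory.quotient 𝒜 (ComplexShape.up ℤ)).map_isZero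
    ((HomologicalComplex.single 𝒜 (ComplexShape.up ℤ) 0).map_isZero hA)
  let e := hZ.iso hA'
  have hT := ((bidual Φ Ψ).mapHomotopyCategory (ComplexShape.up ℤ)).map_isZero hZ
  refine ⟨⟨Z, hS.le_objects _ hSZ⟩, ObjectProperty.homMk e.hom, hSZ,
    fun i => inferInstanceAs (IsIso ((HomotopyCategory.homologyFunctor 𝒜 _ i).map e.hom)),
    ⟨fun _ _ _ => ((HomotopyCategory.homologyFunctor 𝒜 _ j).map_isZero hT).eq_of_src _ _⟩,
    ⟨fun _ _ _ => ((HomotopyCategory.homologyFunctor 𝒜 _ (j + 1)).map_isZero hZ).eq_of_tgt _ _⟩⟩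

end Stalks

end DReflexive

theorem theorem3p7
    {𝒜 : Type u₁} [Category.{v₁} 𝒜] [Abelian 𝒜] {ℬ : Type u₂} [Category.{v₂} ℬ] [Abelian ℬ]
    (Φ : 𝒜ᵒᵖ ⥤ ℬ) [Φ.Additive] (Ψ : ℬᵒᵖ ⥤ 𝒜) [Ψ.Additive]
    (adj : Φ.rightOp ⊣ Ψ)
    (s t : DReflexive.Bound)
    (hΦ : DReflexive.MapsBound Φ s t) (hΨ : DReflexive.MapsBound Ψ t s)
    (P : ObjectProperty (HomotopyCategory 𝒜 (ComplexShape.up ℤ)))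
    (hP : DReflexive.IsAdapted Φ s P)
    (Q : ObjectProperty (HomotopyCategory ℬ (ComplexShape.up ℤ)))
    (hQ : DReflexive.IsAdapted Ψ t Q)
    (hPQ : ∀ X, P X → Q ((DReflexive.onHomotopy Φ).obj (op X)))
    (RΦ : (DReflexive.DCat 𝒜 s)ᵒᵖ ⥤ DReflexive.DCat ℬ t)
    (α : DReflexive.onK Φ hΦ ⋙ DReflexive.locQ ℬ t ⟶ (DReflexive.locQ 𝒜 s).op ⋙ RΦ)
    (hRΦ : DReflexive.IsDerived Φ hΦ RΦ α)
    (RΨ : (DReflexive.DCat ℬ t)ᵒᵖ ⥤ DReflexive.DCat 𝒜 s)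
    (β : DReflexive.onK Ψ hΨ ⋙ DReflexive.locQ 𝒜 s ⟶ (DReflexive.locQ ℬ t).op ⋙ RΨ)
    (hRΨ : DReflexive.IsDerived Ψ hΨ RΨ β)
    (Radj : RΦ.rightOp ⊣ RΨ)
    (hRadj : DReflexive.IsInduced adj hΦ hΨ α β Radj)
    (hAcyc𝒜 : DReflexive.HasEnough (DReflexive.IsPsiPhiAcyclic Φ RΦ RΨ))
    (hAcycℬ : DReflexive.HasEnough (DReflexive.IsAcyclicFor RΨ)) :
    (∀ n : ℕ, DReflexive.CohomDimLE RΦ n →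
      ∀ M : ComposableArrows 𝒜 n, M.Exact →
        (∀ i : Fin (n + 1), DReflexive.reflexive Radj (M.obj i)) →
        ∀ (i : ℕ) (hi : i < n),
          DReflexive.reflexive Radj (kernel (M.map' i (i + 1))) ∧
          DReflexive.reflexive Radj (cokernel (M.map' i (i + 1)))) ∧
    (DReflexive.CohomDimLE RΦ 1 →
      DReflexive.IsExactAbelianSubcategory (DReflexive.reflexive Radj)) := by
  have href (A : 𝒜) := DReflexive.reflexive_iff hP hQ hPQ adj hΦ hΨ α hRΦ β hRΨ Radj hRadj A
  have hiso ⦃X Y : 𝒜⦄ (e : X ≅ Y) (j : ℤ) := DReflexive.unitIsoAt_of_iso hP hQ hPQ adj e j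
  have hmain (n : ℕ) (hn : DReflexive.CohomDimLE RΦ n) (M : ComposableArrows 𝒜 n) (hM : M.Exact)
      (hrefl : ∀ i : Fin (n + 1), DReflexive.reflexive Radj (M.obj i)) (i : ℕ) (hi : i < n) :
      DReflexive.reflexive Radj (kernel (M.map' i (i + 1))) ∧
        DReflexive.reflexive Radj (cokernel (M.map' i (i + 1))) := by
    rw [href, href]
    exact DReflexive.kernel_and_cokernel_of_exact hiso
      (fun E hE h j => DReflexive.unitIsoAt_X₃_iff hP hQ hPQ adj hE h j)
      (fun A j hj => DReflexive.unitIsoAt_of_pos hP hQ hPQ adj A hj)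
      (fun hn₀ A j hj => DReflexive.unitIsoAt_of_lt hP hQ hPQ hΦ α hRΦ adj A hn hn₀ hj)
      hM (fun i => (href _).1 (hrefl i)) i hi
  refine ⟨hmain, fun h => ?_⟩
  have hmap ⦃X Y : 𝒜⦄ (f : X ⟶ Y) (hX : DReflexive.reflexive Radj X)
      (hY : DReflexive.reflexive Radj Y) :=
    -- For `n = 1` a single morphism is a sequence with no exactness condition.
    hmain 1 h (ComposableArrows.mk₁ f) (ComposableArrows.exact₁ _)
      (fun i => by fin_cases i <;> assumption) 0 zero_lt_one
  have : (DReflexive.reflexive Radj).IsClosedUnderIsomorphisms :=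
    ⟨fun e hX => (href _).2 fun j => hiso e j ((href _).1 hX j)⟩
  refine DReflexive.isExactAbelianSubcategory_of_kernels_cokernels _
    (fun A hA => (href A).2 fun j => DReflexive.unitIsoAt_of_isZero hP adj hA j)
    (fun X Y f hX hY => (hmap f hX hY).1) (fun X Y f hX hY => (hmap f hX hY).2)
    -- A biproduct is a split extension, and reflexive objects are closed under extensions.
    (fun X Y hX hY => (href _).2 (DReflexive.unitIsoAt_X₂ hP hQ hPQ adj
      (ShortComplex.Splitting.ofHasBinaryBiproduct X Y).shortExact ((href _).1 hX) ((href _).1 hY)))
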